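/- **Setting.** Let $G$ be a nilpotent group generated by a $k$-tuple $S=(s_1,\dots,s_k)$. Let $\mathfrak C(S)$ be the set of formal commutators over the letters $s_i^{\pm1}$: the letters are formal commutators, and $[c,c']$ is one whenever $c,c'$ are. The image of $[c,c']$ in $G$ is obtained from the images $x,y$ of $c,c'$ as $x^{-1}y^{-1}xy$; formal inversion exchanges $s_i$ and $s_i^{-1}$ and sends $[c,c']$ to $[c',c]$. *Weights.* Fix $w_1,\dots,w_k\in(0,\infty)\times\mathbb R^{d-1}$ ($d\ge1$, lexicographic order) and put $w(s_i^{\pm1})=w_i$, $w([c,c'])=w(c)+w(c')$. Let $\bar w_1<\bar w_2<\cdots$ be the increasing sequence of all values $w(c)$, $G^{\mathfrak w}_j$ the subgroup generated by the images of all $c$ with $w(c)\ge\bar w_j$, and $j_*$ the least integer with $G^{\mathfrak w}_{j_*+1}=\{e\}$. For $g\in G$ of infinite order let $j_{\mathfrak w}(g)=\max\{j:\ g^u\in G^{\mathfrak w}_j\text{ for some integer }u\ge1\}$. *Weight functions.* Let $F_1,\dots,F_k:[1,\infty)\to[1,\infty)$ be nondecreasing, and put $F_{s_i^{\pm1}}=F_i$,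 $F_{[c,c']}=F_cF_{c'}$. Assume: 1. there is $C\ge1$ with $2F_i(r)\le F_i(Cr)$ and $F_i(2r)\le CF_i(r)$ for all $i$ and all $r\ge1$; 2. for all $c,c'\in\mathfrak C(S)$, $w(c)\preceq w(c')$ if and only if there is $C\ge1$ with $F_c(r)\le CF_{c'}(r)$ for all $r\ge1$. For $1\le j\le j_*$ let $\mathbf F_j:[1,\infty)\to[1,\infty)$ be any nondecreasing function with $\mathbf F_j\simeq F_c$ for every $c$ with $w(c)=\bar w_j$, where $f\simeq g$ means that there are constants $a_1,\dots,a_4>0$ with $a_1f(a_2t)\le g(t)\le a_3f(a_4t)$ for all large $t$. For a nondecreasing unbounded $f$ on $[1,\infty)$ write $f^{-1}(t)=\inf\{r\ge1: f(r)\ge t\}$. *Quasi-norm.* Let $c_0,c_1\in\mathfrak C(S)$ have minimal weight $\bar w_1$ (possibly $c_0=c_1$). For a finite word $\omega$ over $\mathfrak C(S)$ let $\deg_c(\omega)$ be the number of occurrences of $c$ or of its formal inverse, and $\pi(\omega)$ its image in $G$. Put $\|e\|=0$ and, for $g\ne e$, $$\|g\|=\inf\{r\ge1:\ g=\pi(\omega)\text{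 for some word }\omega\text{ with }\deg_c(\omega)\le F_c(F_{c_0}^{-1}(r))\text{ for all }c\in\mathfrak C(S)\},$$ and $V(r)=\#\{g:\|g\|\le r\}$. *Measures.* Let $\phi:[0,\infty)\to(0,\infty)$ be continuous, with a constant $C$ such that $\phi(t)\le C\phi(\lambda t)$ for all $\lambda\in(1/2,2)$, $t>0$, and with $\sum_{g}\frac1{\phi(\|g\|)V(\|g\|)}<\infty$. Put $$\nu(g)=\frac{C_\phi}{\phi(\|g\|)V(\|g\|)},\qquad C_\phi^{-1}=\sum_{g}\frac1{\phi(\|g\|)V(\|g\|)}.$$ If $s_i$ has finite order, let $\mu_i$ be an arbitrary symmetric probability measure on $\mathbb Z$. If $s_i$ has infinite order, put $h_i=j_{\mathfrak w}(s_i)$ and $$\mu_i(n)=\frac{C_i}{(1+|n|)\,\phi(F_{c_1}\circ\mathbf F_{h_i}^{-1}(|n|))},\qquad C_i^{-1}=\sum_{n\in\mathbb Z}\frac1{(1+|n|)\,\phi(F_{c_1}\circ\mathbf F_{h_i}^{-1}(|n|))}.$$ Let $\mu(g)=\frac1k\sum_{i=1}^k\sum_{n\in\mathbb Z}\mu_i(n)\mathbf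 1_{s_i^n}(g)$. For a probability measure $\rho$ on $G$ and $f:G\to\mathbb R$ let $\mathcal E_\rho(f,f)=\frac12\sum_{x,y\in G}|f(xy)-f(x)|^2\rho(y)\in[0,\infty]$, and let $\rho^{(n)}$ be the $n$-fold convolution power of $\rho$, with $\rho^{(0)}=\mathbf 1_{e}$. **Theorem.** The series defining each $C_i^{-1}$ (for $s_i$ of infinite order) converges, and there is a constant $C>0$ such that $$\mathcal E_\mu(f,f)\le C\,\mathcal E_\nu(f,f)\qquad\text{for all } f:G\to\mathbb R .$$ In particular, there are a constant $c>0$ and an integer $N\ge1$ such that $\mu^{(2n)}(e)\ge c\,\nu^{(2Nn)}(e)$ for all $n\ge0$. -/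

import Mathlib

open scoped ENNReal
open Filter

namespace NilWalk

/-- Formal commutators over the alphabet `s_1^{±1}, …, s_k^{±1}`.
`letter i true` is `s_i`, `letter i false` is `s_i^{-1}`. -/
inductive FormalComm (k : ℕ) : Type
  | letter (i : Fin k) (b : Bool) : FormalComm k
  | bracket (c₁ c₂ : FormalComm k) : FormalComm k
  deriving DecidableEq

namespace FormalComm

variable {k : ℕ}

/-- The length of a formal commutator. -/
def length : FormalComm k → ℕ
  | letter _ _ => 1
  | bracket c₁ c₂ => c₁.length + c₂.length

/-- The formal inverse: `(s_i^{±1})^{-1} = s_i^{∓1}` and `[c₁,c₂]^{-1} = [c₂,c₁]`. -/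
def inv : FormalComm k → FormalComm k
  | letter i b => letter i (!b)
  | bracket c₁ c₂ => bracket c₂ c₁

/-- The image in a group of a formal commutator, with `[x,y] = x⁻¹ y⁻¹ x y`. -/
def eval {G : Type*} [Group G] (s : Fin k → G) : FormalComm k → G
  | letter i b => if b then s i else (s i)⁻¹
  | bracket c₁ c₂ => (c₁.eval s)⁻¹ * (c₂.eval s)⁻¹ * c₁.eval s * c₂.eval s

/-- The weight of a formal commutator, in `ℝ^{d+1}` with the lexicographic order. -/
def weight {d : ℕ} (w : Fin k → Lex (Fin (d + 1) → ℝ)) :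
    FormalComm k → Lex (Fin (d + 1) → ℝ)
  | letter i _ => w i
  | bracket c₁ c₂ => c₁.weight w + c₂.weight w

/-- The weight function `F_c` of a formal commutator: `F_{[c₁,c₂]} = F_{c₁} F_{c₂}`. -/
def weightFun (F : Fin k → ℝ → ℝ) : FormalComm k → ℝ → ℝ
  | letter i _, r => F i r
  | bracket c₁ c₂, r => c₁.weightFun F r * c₂.weightFun F r

/-- The position of `w(c)` in the increasing sequence `w̄_1 < w̄_2 < ⋯` of all weight values:
`weightIndex w c = j` says `w(c) = w̄_j`, and `j ≤ weightIndex w c` says `w(c) ≥ w̄_j`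
(see `weight_le_iff` below). -/
noncomputable def weightIndex {d : ℕ} (w : Fin k → Lex (Fin (d + 1) → ℝ))
    (c : FormalComm k) : ℕ :=
  {v | ∃ c' : FormalComm k, c'.weight w = v ∧ v ≤ c.weight w}.ncard

theorem finite_length_le (n : ℕ) : {c : FormalComm k | c.length ≤ n}.Finite := by
  induction n with
  | zero =>
    refine Set.Finite.subset Set.finite_empty ?_
    have hpos : ∀ c : FormalComm k, 0 < c.length := by
      intro c
      induction c with
      | letter i b => simp [length]
      | bracket c₁ c₂ h₁ h₂ => simp only [length]; omega
    intro c hc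
    have := hpos c
    simp only [Set.mem_ofPred_eq] at hc
    omega
  | succ n ih =>
    have hpos : ∀ c : FormalComm k, 0 < c.length := by
      intro c
      induction c with
      | letter i b => simp [length]
      | bracket c₁ c₂ h₁ h₂ => simp only [length]; omega
    refine Set.Finite.subset ((Set.finite_range
      (fun p : Fin k × Bool => letter p.1 p.2)).union
      (Set.Finite.image2 bracket ih ih)) ?_
    rintro (⟨i, b⟩ | ⟨c₁, c₂⟩) hc
    · exact Or.inl ⟨(i, b), rfl⟩
    · refine Or.inr ⟨c₁, ?_, c₂, ?_, rfl⟩ <;>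
      · have h₁ := hpos c₁
        have h₂ := hpos c₂
        simp only [Set.mem_ofPred_eq, length] at hc ⊢
        omega

theorem finite_weights_le {d : ℕ} (w : Fin k → Lex (Fin (d + 1) → ℝ))
    (hw : ∀ i, 0 < ofLex (w i) 0) (x : Lex (Fin (d + 1) → ℝ)) :
    {v | ∃ c' : FormalComm k, c'.weight w = v ∧ v ≤ x}.Finite := by
  obtain ⟨m, hm, hmw⟩ : ∃ m : ℝ, 0 < m ∧ ∀ i, m ≤ ofLex (w i) 0 := by
    rcases isEmpty_or_nonempty (Fin k) with h | h
    · exact ⟨1, one_pos, fun i => h.elim i⟩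
    · obtain ⟨i, hi⟩ := Finite.exists_min (fun i => ofLex (w i) 0)
      exact ⟨_, hw i, hi⟩
  have hlen : ∀ c : FormalComm k, m * c.length ≤ ofLex (c.weight w) 0 := by
    intro c
    induction c with
    | letter i b => simpa [length, weight] using hmw i
    | bracket c₁ c₂ h₁ h₂ =>
      have : ofLex ((bracket c₁ c₂).weight w) 0
          = ofLex (c₁.weight w) 0 + ofLex (c₂.weight w) 0 := rfl
      rw [this]
      simp only [length]
      push_cast
      linarith
  have hlex : ∀ v : Lex (Fin (d + 1) → ℝ), v ≤ x → ofLex v 0 ≤ ofLex x 0 := by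
    intro v hv
    rcases hv.eq_or_lt with h | ⟨i, h₁, h₂⟩
    · rw [h]
    · rcases (Fin.zero_le i).eq_or_lt with h | h
      · subst h; exact h₂.le
      · exact (h₁ 0 h).le
  refine Set.Finite.subset ((finite_length_le (k := k)
    ⌊ofLex x 0 / m⌋₊).image (fun c => c.weight w)) ?_
  rintro v ⟨c, rfl, hv⟩
  refine ⟨c, ?_, rfl⟩
  have h := (hlen c).trans (hlex _ hv)
  exact Nat.le_floor (by rw [le_div_iff₀ hm]; linarith)

/-- `weightIndex` orders formal commutators as their weights do. -/
theorem weight_le_iff {d : ℕ} (w : Fin k → Lex (Fin (d + 1) → ℝ))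
    (hw : ∀ i, 0 < ofLex (w i) 0) (c c' : FormalComm k) :
    c.weight w ≤ c'.weight w ↔ c.weightIndex w ≤ c'.weightIndex w := by
  constructor
  · intro h
    refine Set.ncard_le_ncard ?_ (finite_weights_le w hw _)
    rintro v ⟨b, hb, hv⟩
    exact ⟨b, hb, hv.trans h⟩
  · intro h
    by_contra hlt
    rw [not_le] at hlt
    refine absurd h (not_le.mpr (Set.ncard_lt_ncard ⟨?_, ?_⟩ (finite_weights_le w hw _)))
    · rintro v ⟨b, hb, hv⟩
      exact ⟨b, hb, hv.trans hlt.le⟩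
    · intro hsub
      obtain ⟨-, -, h'⟩ := hsub ⟨c, rfl, le_refl _⟩
      exact absurd h' (not_le.mpr hlt)

end FormalComm

section Weights

variable {G : Type*} [Group G] {k d : ℕ}

/-- The subgroup `G^𝔴_j`, generated by the images of the formal commutators `c` with
`w(c) ≥ w̄_j` (`j ≥ 1`). -/
def filtration (s : Fin k → G) (w : Fin k → Lex (Fin (d + 1) → ℝ)) (j : ℕ) : Subgroup G :=
  Subgroup.closure {g | ∃ c : FormalComm k, j ≤ c.weightIndex w ∧ c.eval s = g}

/-- `j_*`: the smallest integer with `G^𝔴_{j_*+1} = {e}`. -/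
noncomputable def jStar (s : Fin k → G) (w : Fin k → Lex (Fin (d + 1) → ℝ)) : ℕ :=
  sInf {j | filtration s w (j + 1) = ⊥}

/-- `j_𝔴(g) = max {j : ∃ u ≥ 1, g^u ∈ G^𝔴_j}`; meaningful for `g` of infinite order. -/
noncomputable def jIndex (s : Fin k → G) (w : Fin k → Lex (Fin (d + 1) → ℝ)) (g : G) : ℕ :=
  sSup {j | ∃ u : ℕ, 1 ≤ u ∧ g ^ u ∈ filtration s w j}

/-- `f` is a nondecreasing function from `[1,∞)` to `[1,∞)`. -/
def IsIncreasing (f : ℝ → ℝ) : Prop :=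
  MonotoneOn f (Set.Ici 1) ∧ ∀ r, 1 ≤ r → 1 ≤ f r

/-- Doubling and reverse doubling of the weight functions. -/
def IsDoublingSystem (F : Fin k → ℝ → ℝ) : Prop :=
  ∃ C : ℝ, 1 ≤ C ∧ ∀ i, ∀ r, 1 ≤ r → 2 * F i r ≤ F i (C * r) ∧ F i (2 * r) ≤ C * F i r

/-- Compatibility of weights and weight functions: `w(c) ≼ w(c')` if and only if `F_c` is
bounded by a constant multiple of `F_{c'}`. -/
def IsCompatible (w : Fin k → Lex (Fin (d + 1) → ℝ)) (F : Fin k → ℝ → ℝ) : Prop :=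
  ∀ c c' : FormalComm k, c.weight w ≤ c'.weight w ↔
    ∃ C : ℝ, 1 ≤ C ∧ ∀ r, 1 ≤ r → c.weightFun F r ≤ C * c'.weightFun F r

/-- `c` has minimal weight among all formal commutators. -/
def HasMinWeight (w : Fin k → Lex (Fin (d + 1) → ℝ)) (c : FormalComm k) : Prop :=
  ∀ c' : FormalComm k, c.weight w ≤ c'.weight w

/-- `f ≃ g` at infinity: `c₁ f(c₂ t) ≤ g(t) ≤ c₃ f(c₄ t)` for large `t`. -/
def Simeq (f g : ℝ → ℝ) : Prop :=
  ∃ c₁ c₂ c₃ c₄ : ℝ, 0 < c₁ ∧ 0 < c₂ ∧ 0 < c₃ ∧ 0 < c₄ ∧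
    ∀ᶠ t in atTop, c₁ * f (c₂ * t) ≤ g t ∧ g t ≤ c₃ * f (c₄ * t)

/-- The (generalized) inverse `t ↦ inf {r ≥ 1 : t ≤ f(r)}` of an increasing unbounded function
`f : [1,∞) → [1,∞)`. It is the usual inverse on the range of `f` if `f` is injective, and it
is `1` below `f(1)`. -/
noncomputable def genInv (f : ℝ → ℝ) (t : ℝ) : ℝ := sInf {r | 1 ≤ r ∧ t ≤ f r}

/-- The number of occurrences of `c^{±1}` in the word `ω` over the formal commutators. -/
def deg (c : FormalComm k) (ω : List (FormalComm k)) : ℕ :=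
  ω.countP (fun b => decide (b = c ∨ b = c.inv))

/-- The image in `G` of a word over the formal commutators. (As the set of formal commutators is
closed under formal inversion, no further inverse letters are needed.) -/
def evalWord (s : Fin k → G) (ω : List (FormalComm k)) : G :=
  (ω.map (fun c => c.eval s)).prod

open Classical in
/-- The quasi-norm `‖g‖_{𝔉,com}`; `c₀` is a formal commutator of minimal weight, so that
`F_{c₀}` is the function `F_S = F_{ℭ(S)}`. -/
noncomputable def comNorm (s : Fin k → G) (F : Fin k → ℝ → ℝ) (c₀ : FormalComm k) (g : G) : ℝ :=
  if g = 1 then 0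
  else sInf {r | 1 ≤ r ∧ ∃ ω : List (FormalComm k), evalWord s ω = g ∧
    ∀ c : FormalComm k, (deg c ω : ℝ) ≤ c.weightFun F (genInv (c₀.weightFun F) r)}

end Weights

section Walks

variable {G : Type*} [Group G]

/-- The volume function `V(r) = #{g : ‖g‖ ≤ r}`. -/
noncomputable def volumeFun (N : G → ℝ) (r : ℝ) : ℝ := ({g | N g ≤ r}.ncard : ℝ)

/-- The weight `1 / (φ(‖g‖) V(‖g‖))`. -/
noncomputable def radialWeight (φ : ℝ → ℝ) (N : G → ℝ) (g : G) : ℝ :=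
  1 / (φ (N g) * volumeFun N (N g))

/-- The norm-radial probability `ν(g) = C_φ / (φ(‖g‖) V(‖g‖))`. -/
noncomputable def radialMeasure (φ : ℝ → ℝ) (N : G → ℝ) (g : G) : ℝ :=
  (∑' x, radialWeight φ N x)⁻¹ * radialWeight φ N g

/-- The weight `1 / ((1 + |n|) φ(F₁ ∘ F₂⁻¹(|n|)))` on `ℤ`. -/
noncomputable def stepWeight (φ F₁ F₂ : ℝ → ℝ) (n : ℤ) : ℝ :=
  1 / ((1 + |(n : ℝ)|) * φ (F₁ (genInv F₂ |(n : ℝ)|)))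

/-- Symmetric probability measures on `ℤ`. -/
def IsSymmProb (p : ℤ → ℝ) : Prop :=
  (∀ n, 0 ≤ p n) ∧ (∀ n, p (-n) = p n) ∧ HasSum p 1

open Classical in
/-- `μ(g) = (1/k) ∑_i ∑_{n ∈ ℤ} μ_i(n) 1_{s_i^n}(g)`. -/
noncomputable def mixture {k : ℕ} (s : Fin k → G) (p : Fin k → ℤ → ℝ) (g : G) : ℝ :=
  (1 / (k : ℝ)) * ∑ i, ∑' n : ℤ, if s i ^ n = g then p i n else 0

/-- The Dirichlet form `(1/2) ∑_{x,y} |f(xy) - f(x)|² μ(y)`, with values in `[0,∞]`. -/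
noncomputable def dirichlet (μ : G → ℝ) (f : G → ℝ) : ℝ≥0∞ :=
  (1 / 2) * ∑' x, ∑' y, ENNReal.ofReal (|f (x * y) - f x| ^ 2 * μ y)

open Classical in
/-- The convolution powers `μ^{(n)}`. -/
noncomputable def convPow (μ : G → ℝ) : ℕ → G → ℝ
  | 0, g => if g = 1 then 1 else 0
  | n + 1, g => ∑' x, convPow μ n x * μ (x⁻¹ * g)

end Walks

end NilWalk

open NilWalk

/-! ### Formal commutators and iterated conjugation -/

namespace NilWalk
namespace FormalComm

variable {k : ℕ}

/-! Let B(ρ) (`comBall`) be the set of elements written with at most F_c(ρ) occurrences of each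
c^{±1}; up to constant factors in ρ these are the quasi-norm balls of radius F_{c₀}(ρ). For s_i of
infinite order put ρ = 𝐅_{h_i}⁻¹(|n|). Some power of s_i is a product of commutators c whose F_c
dominates 𝐅_{h_i}, so v = s_i^n lies in B(aρ) once |n| is large. The increment Δ(v) = ∑_x |f(xv) -
f(x)|² satisfies Δ(v) ≤ 2(Δ(y) + Δ(vy)). This is averaged over y ∈ zB(ρ), where z is a power of s_i
that pushes zB(ρ) and vzB(ρ) into the annulus E_n = B(bρ) \ B(ρ) (`exists_pow_mem_annulus`). There
the radial weight is at least a constant times 1/(φ(F_{c₁}(ρ)) |B(ρ)|) (`exists_le_radialWeight`),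
so the n-th term of the form of μ_i is at most a constant times (1+|n|)⁻¹ ∑_{x ∈ E_n} ν(x)Δ(x). A
given x lies in E_n only for |n| within a bounded ratio, and ∑ 1/(1+|n|) over such n is bounded.
Summation over n gives the comparison (`exists_tsum_stepWeight_le`); Δ = 1 gives the convergence of
the series. If s_i has finite order, it has finitely many powers, each charged by ν.

The group theory enters through volume doubling (`exists_ncard_comBall_le`), a collection process
(`exists_cover`): a shortest commutator b is moved to the left at the price of longer brackets
[c,b], whose number is still O(F_{[c,b]}); its exponent is split as a multiple of ⌊F_b⌋ plus a
remainder, which gives boundedly many translates, and the process stops by nilpotency.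

For return probabilities, the form inequality says that a lazy version Y of ν lies below a lazy
version X of μ as quadratic forms. The trace T ↦ ⟨Tδ,δ⟩ on self-adjoint left-invariant operators
then gives tr Y^{2k+1} ≤ tr X^{2k+1} (`IsInvSymm.inner_odd_pow_le`). Binomial expansion removes the
laziness up to an exponentially small error, which is harmless unless ν itself returns exponentially
rarely; in that case μ^{(2n)}(e) ≥ μ^{(2)}(e)^n suffices. -/

@[simp] theorem inv_inv (c : FormalComm k) : c.inv.inv = c := by cases c <;> simp [inv]

theorem length_inv (c : FormalComm k) : c.inv.length = c.length := by
  cases c <;> simp [inv, length, add_comm]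

theorem length_pos (c : FormalComm k) : 0 < c.length := by
  induction c with
  | letter i b => simp [length]
  | bracket c₁ c₂ h₁ h₂ => simp only [length]; omega

theorem eval_inv {G : Type*} [Group G] (s : Fin k → G) (c : FormalComm k) :
    c.inv.eval s = (c.eval s)⁻¹ := by
  cases c with
  | letter i b => cases b <;> simp [inv, eval]
  | bracket a b => simp [inv, eval, mul_assoc]

theorem weight_inv {d : ℕ} (w : Fin k → Lex (Fin (d + 1) → ℝ)) (c : FormalComm k) :
    c.inv.weight w = c.weight w := by
  cases c <;> simp [inv, weight, add_comm]

theorem weightFun_inv (F : Fin k → ℝ → ℝ) (c : FormalComm k) (r : ℝ) :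
    c.inv.weightFun F r = c.weightFun F r := by
  cases c <;> simp [inv, weightFun, mul_comm]

theorem weightIndex_inv {d : ℕ} (w : Fin k → Lex (Fin (d + 1) → ℝ)) (c : FormalComm k) :
    c.inv.weightIndex w = c.weightIndex w := by
  simp only [weightIndex, weight_inv]

open scoped commutatorElement in
-- One of the two entries of a bracket of length above 2^(j+1) has length above 2^j, and a
-- commutator with any element descends one step. The bound is crude, but some length beyond which
-- all commutators vanish is all that is needed.
theorem eval_mem_lowerCentralSeries {G : Type*} [Group G] (s : Fin k → G) (c : FormalComm k) :
    ∀ j, 2 ^ j < c.length → c.eval s ∈ (⊤ : Subgroup G).lowerCentralSeries j := by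
  induction c with
  | letter i b =>
    intro j hj
    simp only [length] at hj
    exact absurd (Nat.one_le_two_pow (n := j)) (by omega)
  | bracket x y hx hy =>
    intro j hj
    cases j with
    | zero => simp
    | succ j =>
      have key : (bracket x y).eval s = ⁅(x.eval s)⁻¹, (y.eval s)⁻¹⁆ := by
        simp [eval, commutatorElement_def]
      rw [key, Subgroup.lowerCentralSeries_succ]
      simp only [length, pow_succ] at hj
      by_cases h : 2 ^ j < x.length
      · exact Subgroup.commutator_mem_commutator (inv_mem (hx j h)) (Subgroup.mem_top _)
      · rw [Subgroup.commutator_comm]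
        exact Subgroup.commutator_mem_commutator (Subgroup.mem_top _)
          (inv_mem (hy j (by omega)))

theorem exists_length_eval_eq_one {G : Type*} [Group G] [Group.IsNilpotent G] (s : Fin k → G) :
    ∃ L : ℕ, ∀ c : FormalComm k, L < c.length → c.eval s = 1 := by
  obtain ⟨n, hn⟩ := Subgroup.nilpotent_iff_lowerCentralSeries.1 (inferInstance : Group.IsNilpotent G)
  refine ⟨2 ^ n, fun c hc => ?_⟩
  have := eval_mem_lowerCentralSeries s c n hc
  rwa [hn, Subgroup.mem_bot] at this

/-- Conjugation of a word by the letter `b`, as a substitution `c ↦ c [c, b]`. -/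
def conjStep (b : FormalComm k) (ω : List (FormalComm k)) : List (FormalComm k) :=
  ω.flatMap (fun c => [c, bracket c b])

theorem conjStep_iterate_append (b : FormalComm k) (m : ℕ) (ω ω' : List (FormalComm k)) :
    (conjStep b)^[m] (ω ++ ω') = (conjStep b)^[m] ω ++ (conjStep b)^[m] ω' := by
  induction m generalizing ω ω' with
  | zero => rfl
  | succ m ih =>
    simp only [Function.iterate_succ_apply]
    rw [← ih]
    simp [conjStep]

theorem count_letter_conjStep (b : FormalComm k) (i : Fin k) (e : Bool)
    (ω : List (FormalComm k)) :
    (conjStep b ω).count (letter i e) = ω.count (letter i e) := by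
  induction ω with
  | nil => rfl
  | cons x t ih =>
    have : conjStep b (x :: t) = x :: bracket x b :: conjStep b t := rfl
    rw [this]
    simp [List.count_cons, ih]

/-- A new copy of [x,b] comes only from a copy of x, so the counts satisfy a triangular recursion
and grow polynomially in the number of steps. -/
theorem count_bracket_conjStep (b x y : FormalComm k) (ω : List (FormalComm k)) :
    (conjStep b ω).count (bracket x y) =
      ω.count (bracket x y) + if y = b then ω.count x else 0 := by
  induction ω with
  | nil => simp [conjStep]
  | cons z t ih =>
    have : conjStep b (z :: t) = z :: bracket z b :: conjStep b t := rfl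
    rw [this]
    simp only [List.count_cons, ih, beq_iff_eq, bracket.injEq]
    by_cases hy : y = b
    · subst hy
      simp only [and_true, if_true]
      omega
    · have : ¬ b = y := fun h => hy h.symm
      simp [hy, this]

theorem count_le_count_conjStep (b c : FormalComm k) (ω : List (FormalComm k)) :
    ω.count c ≤ (conjStep b ω).count c := by
  cases c with
  | letter i e => rw [count_letter_conjStep]
  | bracket x y => rw [count_bracket_conjStep]; omega

theorem count_conjStep_iterate_mono (b c : FormalComm k) (ω : List (FormalComm k)) :
    Monotone fun m => ((conjStep b)^[m] ω).count c := by
  refine monotone_nat_of_le_succ fun m => ?_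
  rw [Function.iterate_succ_apply']
  exact count_le_count_conjStep b c _

theorem mem_conjStep_iterate {S : Set (FormalComm k)} {b : FormalComm k}
    (hS : ∀ c ∈ S, bracket c b ∈ S) (m : ℕ) {ω : List (FormalComm k)} (hω : ∀ c ∈ ω, c ∈ S) :
    ∀ c ∈ (conjStep b)^[m] ω, c ∈ S := by
  induction m with
  | zero => exact hω
  | succ m ih =>
    intro c hc
    rw [Function.iterate_succ_apply'] at hc
    simp only [conjStep, List.mem_flatMap, List.mem_cons, List.not_mem_nil, or_false] at hc
    obtain ⟨x, hx, rfl | rfl⟩ := hc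
    · exact ih _ hx
    · exact hS _ (ih _ hx)

/-- Polynomial control of the number of letters created by iterated conjugation. -/
theorem exists_count_conjStep_iterate_le (b : FormalComm k) {K : FormalComm k → ℝ}
    (hK : ∀ c, 0 ≤ K c) {N : ℝ} (hN : 0 ≤ N) (c : FormalComm k) :
    ∃ K' : ℝ, 0 ≤ K' ∧ ∀ f : FormalComm k → ℝ, (∀ x y, f (bracket x y) = f x * f y) →
      (∀ x, 0 ≤ f x) → ∀ ω : List (FormalComm k), (∀ x, (ω.count x : ℝ) ≤ K x * f x) →
      ∀ m : ℕ, (m : ℝ) ≤ N * f b → (((conjStep b)^[m] ω).count c : ℝ) ≤ K' * f c := by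
  induction c with
  | letter i e =>
    refine ⟨K (letter i e), hK _, fun f _ _ ω hω m _ => ?_⟩
    have : ((conjStep b)^[m] ω).count (letter i e) = ω.count (letter i e) := by
      induction m with
      | zero => rfl
      | succ m ih =>
        rw [Function.iterate_succ_apply', count_letter_conjStep]
        refine ih ?_
        push_cast at *
        linarith
    rw [this]
    exact hω _
  | bracket x y hx _ =>
    obtain ⟨K', hK', h⟩ := hx
    -- For y = b each of the at most N f_b steps adds at most K' f_x copies of [x,b], and f_x f_b =
    -- f_{[x,b]}. The constant does not depend on f, which later is c ↦ F_c(ρ) with ρ arbitrary.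
    refine ⟨K (bracket x y) + N * K', add_nonneg (hK _) (mul_nonneg hN hK'),
      fun f hf hf0 ω hω m hm => ?_⟩
    have hfx := hf0 x
    have hfy := hf0 y
    by_cases hy : y = b
    · subst hy
      have main : ∀ j ≤ m, (((conjStep y)^[j] ω).count (bracket x y) : ℝ) ≤
          K (bracket x y) * f (bracket x y) + j * (K' * f x) := by
        intro j hj
        induction j with
        | zero => simpa using hω (bracket x y)
        | succ j ih =>
          rw [Function.iterate_succ_apply', count_bracket_conjStep]
          have h1 := ih (by omega)
          have h2 := h f hf hf0 ω hω j (le_trans (by exact_mod_cast (by omega)) hm)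
          push_cast
          simp only [if_true]
          linarith
      refine (main m le_rfl).trans ?_
      have : (m : ℝ) * (K' * f x) ≤ N * f y * (K' * f x) :=
        mul_le_mul_of_nonneg_right hm (mul_nonneg hK' hfx)
      rw [hf]
      linarith
    · have : ((conjStep b)^[m] ω).count (bracket x y) = ω.count (bracket x y) := by
        clear hm
        induction m with
        | zero => rfl
        | succ m ih => rw [Function.iterate_succ_apply', count_bracket_conjStep, if_neg hy, ih]; rfl
      rw [this]
      refine (hω _).trans (mul_le_mul_of_nonneg_right ?_ (hf0 _))
      have := mul_nonneg hN hK'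
      linarith

end FormalComm

open FormalComm

/-! ### Collection of words and covering by translates -/

section Words

variable {G : Type*} [Group G] {k : ℕ}

theorem evalWord_append (s : Fin k → G) (ω ω' : List (FormalComm k)) :
    evalWord s (ω ++ ω') = evalWord s ω * evalWord s ω' := by
  simp [evalWord]

theorem evalWord_replicate (s : Fin k → G) (n : ℕ) (c : FormalComm k) :
    evalWord s (List.replicate n c) = c.eval s ^ n := by
  simp [evalWord]

theorem evalWord_reverse_inv (s : Fin k → G) (ω : List (FormalComm k)) :
    evalWord s (ω.reverse.map FormalComm.inv) = (evalWord s ω)⁻¹ := by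
  simp [evalWord, List.prod_inv_reverse, Function.comp_def, eval_inv, List.map_reverse]

theorem evalWord_conjStep_iterate (s : Fin k → G) (b : FormalComm k) (m : ℕ)
    (ω : List (FormalComm k)) :
    evalWord s ((conjStep b)^[m] ω) = (b.eval s ^ m)⁻¹ * evalWord s ω * b.eval s ^ m := by
  have one (ω : List (FormalComm k)) :
      evalWord s (conjStep b ω) = (b.eval s)⁻¹ * evalWord s ω * b.eval s := by
    induction ω with
    | nil => simp [conjStep, evalWord]
    | cons x t ih =>
      have h : conjStep b (x :: t) = [x, bracket x b] ++ conjStep b t := rfl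
      have h' : x :: t = [x] ++ t := rfl
      rw [h, h', evalWord_append, ih, evalWord_append]
      simp [evalWord, eval, mul_assoc]
  induction m with
  | zero => simp
  | succ m ih =>
    rw [Function.iterate_succ_apply', one, ih, pow_succ]
    group

theorem deg_append (c : FormalComm k) (ω ω' : List (FormalComm k)) :
    deg c (ω ++ ω') = deg c ω + deg c ω' := by
  simp [deg]

theorem deg_cons (c x : FormalComm k) (ω : List (FormalComm k)) :
    deg c (x :: ω) = deg c ω + if x = c ∨ x = c.inv then 1 else 0 := by
  simp [deg, List.countP_cons]

theorem deg_reverse_inv (c : FormalComm k) (ω : List (FormalComm k)) :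
    deg c (ω.reverse.map FormalComm.inv) = deg c ω := by
  have h : ∀ x : FormalComm k, (x.inv = c ∨ x.inv = c.inv) ↔ (x = c ∨ x = c.inv) := by
    intro x
    constructor
    · rintro (h | h)
      · right; rw [← h, FormalComm.inv_inv]
      · left; rw [← FormalComm.inv_inv x, h, FormalComm.inv_inv]
    · rintro (h | h)
      · right; rw [h]
      · left; rw [h, FormalComm.inv_inv]
  simp only [deg, List.map_reverse, List.countP_reverse, List.countP_map]
  congr 1
  funext x
  simp only [Function.comp]
  exact decide_eq_decide.2 (h x)

theorem count_le_deg (c : FormalComm k) (ω : List (FormalComm k)) : ω.count c ≤ deg c ω := by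
  unfold List.count deg
  refine List.countP_mono_left fun x _ hx => ?_
  simp only [beq_iff_eq] at hx
  simp [hx]

theorem deg_pos_iff (c : FormalComm k) (ω : List (FormalComm k)) :
    0 < deg c ω ↔ ∃ x ∈ ω, x = c ∨ x = c.inv := by
  simp [deg, List.countP_pos_iff]

theorem deg_le_length (c : FormalComm k) (ω : List (FormalComm k)) : deg c ω ≤ ω.length :=
  List.countP_le_length

/-- All occurrences of `b` and of its formal inverse can be moved to the left. -/
theorem exists_extract (s : Fin k → G) (b : FormalComm k) (N : ℕ) (ω : List (FormalComm k))
    (hω : deg b ω ≤ N) :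
    ∃ n : ℤ, ∃ ω' : List (FormalComm k), |n| ≤ deg b ω ∧
      evalWord s ω = b.eval s ^ n * evalWord s ω' ∧
      ∀ c, ω'.count c ≤
        ((conjStep b)^[N] (ω.filter fun x => !decide (x = b ∨ x = b.inv))).count c +
        ((conjStep b.inv)^[N] (ω.filter fun x => !decide (x = b ∨ x = b.inv))).count c := by
  induction ω with
  | nil => exact ⟨0, [], by simp, by simp [evalWord], by simp⟩
  | cons x t ih =>
    rw [deg_cons] at hω
    obtain ⟨n, ω', hn, he, hc⟩ := ih (by omega)
    have hx : evalWord s (x :: t) = x.eval s * evalWord s t := by simp [evalWord]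
    -- A leading b^{±1} only changes the exponent. Any other leading letter x crosses b^n by x b^n =
    -- b^n (b^{-n} x b^n), which costs |n| ≤ N conjugation steps by b or by its inverse, according
    -- to the sign of n.
    by_cases hb : x = b ∨ x = b.inv
    · rw [deg_cons, if_pos hb, List.filter_cons_of_neg (by simp [hb])]
      rcases hb with rfl | rfl
      · refine ⟨n + 1, ω', ?_, ?_, hc⟩
        · rw [abs_le] at hn ⊢; push_cast; omega
        · rw [hx, he, add_comm, zpow_add, zpow_one, mul_assoc]
      · refine ⟨n - 1, ω', ?_, ?_, hc⟩
        · rw [abs_le] at hn ⊢; push_cast; omega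
        · rw [hx, he, eval_inv, sub_eq_neg_add, zpow_add, zpow_neg_one, mul_assoc]
    · rw [deg_cons, if_neg hb, List.filter_cons_of_pos (by simp [hb])]
      have happ (e : FormalComm k) (l : List (FormalComm k)) :
          (conjStep e)^[N] (x :: l) = (conjStep e)^[N] [x] ++ (conjStep e)^[N] l :=
        conjStep_iterate_append e N [x] l
      have hnN : n.natAbs ≤ N := by
        rw [if_neg hb] at hω
        have : (n.natAbs : ℤ) ≤ deg b t := by rwa [Int.natCast_natAbs]
        omega
      rcases Int.natAbs_eq n with h | h
      · refine ⟨n, (conjStep b)^[n.natAbs] [x] ++ ω', hn, ?_, fun c => ?_⟩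
        · have hz : b.eval s ^ n = b.eval s ^ n.natAbs := by
            conv_lhs => rw [h]
            exact zpow_natCast _ _
          rw [evalWord_append, evalWord_conjStep_iterate, hx, he, hz]
          simp [evalWord, mul_assoc]
        · have h1 := count_conjStep_iterate_mono b c [x] hnN
          have h2 := hc c
          rw [happ b (t.filter _), happ b.inv (t.filter _)]
          simp only [List.count_append] at *
          omega
      · refine ⟨n, (conjStep b.inv)^[n.natAbs] [x] ++ ω', hn, ?_, fun c => ?_⟩
        · have hz : b.eval s ^ n = ((b.eval s)⁻¹) ^ n.natAbs := by
            conv_lhs => rw [h]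
            rw [zpow_neg, zpow_natCast, inv_pow]
          rw [evalWord_append, evalWord_conjStep_iterate, hx, he, hz, eval_inv]
          simp [evalWord, mul_assoc]
        · have h1 := count_conjStep_iterate_mono b.inv c [x] hnN
          have h2 := hc c
          rw [happ b (t.filter _), happ b.inv (t.filter _)]
          simp only [List.count_append] at *
          omega


theorem deg_le_count_add (c : FormalComm k) (ω : List (FormalComm k)) :
    deg c ω ≤ ω.count c + ω.count c.inv := by
  induction ω with
  | nil => simp [deg]
  | cons x t ih =>
    rw [deg_cons, List.count_cons, List.count_cons]
    by_cases h : x = c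
    · simp [h]; omega
    · by_cases h' : x = c.inv
      · simp [h']; omega
      · simp [h, h', ih]

/-- A set of formal commutators stable under formal inversion and brackets. -/
def IsBracketClosed (S : Set (FormalComm k)) : Prop :=
  (∀ c ∈ S, c.inv ∈ S) ∧ ∀ c ∈ S, ∀ c' ∈ S, bracket c c' ∈ S

/-- The multiplicative functions `c ↦ F_c(r)`, without reference to `F` and `r`. -/
structure IsProfile (f : FormalComm k → ℝ) : Prop where
  bracket : ∀ x y, f (bracket x y) = f x * f y
  one_le : ∀ x, 1 ≤ f x
  inv : ∀ x, f x.inv = f x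

theorem IsProfile.nonneg {f : FormalComm k → ℝ} (hf : IsProfile f) (x : FormalComm k) : 0 ≤ f x :=
  zero_le_one.trans (hf.one_le x)

/-- Brackets are strictly longer than a shortest element b, so collection never recreates b^{±1}. -/
theorem IsBracketClosed.bracket_mem_diff {S : Set (FormalComm k)} (hS : IsBracketClosed S)
    {b : FormalComm k} (hmin : ∀ c ∈ S, b.length ≤ c.length) {c c' : FormalComm k} (hc : c ∈ S)
    (hc' : c' ∈ S) : bracket c c' ∈ S \ {b, b.inv} := by
  have hlen : b.length < (bracket c c').length := by
    have h1 := hmin c hc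
    have h2 := length_pos c'
    simp only [length]
    omega
  refine ⟨hS.2 c hc c' hc', ?_⟩
  rintro (h | h)
  · rw [h] at hlen; exact lt_irrefl _ hlen
  · rw [Set.mem_singleton_iff.1 h, length_inv] at hlen; exact lt_irrefl _ hlen

theorem IsBracketClosed.diff {S : Set (FormalComm k)} (hS : IsBracketClosed S)
    {b : FormalComm k} (hmin : ∀ c ∈ S, b.length ≤ c.length) :
    IsBracketClosed (S \ {b, b.inv}) := by
  refine ⟨fun c hc => ⟨hS.1 c hc.1, ?_⟩, fun c hc c' hc' => hS.bracket_mem_diff hmin hc.1 hc'.1⟩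
  rintro (h | h)
  · exact hc.2 (Or.inr (by rw [Set.mem_singleton_iff, ← h, FormalComm.inv_inv]))
  · refine hc.2 (Or.inl ?_)
    rw [← FormalComm.inv_inv c, Set.mem_singleton_iff.1 h, FormalComm.inv_inv]

/-- The number of conjugations is `deg b ω`, which is O(f_b): exactly the range where iterated
conjugation keeps every count O(f_c). The constants depend on K but not on the profile f. -/
theorem exists_extract_bound (s : Fin k → G) {S : Set (FormalComm k)} (hS : IsBracketClosed S)
    {b : FormalComm k} (hb : b ∈ S) (hmin : ∀ c ∈ S, b.length ≤ c.length)
    {K : FormalComm k → ℝ} (hK : ∀ c, 0 ≤ K c) :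
    ∃ K' : FormalComm k → ℝ, (∀ c, 0 ≤ K' c) ∧ ∀ f, IsProfile f → ∀ ω : List (FormalComm k),
      (∀ c ∈ ω, c ∈ S) → (∀ c, (ω.count c : ℝ) ≤ K c * f c) →
      ∃ n : ℤ, ∃ ω' : List (FormalComm k), |(n : ℝ)| ≤ (K b + K b.inv) * f b ∧
        evalWord s ω = b.eval s ^ n * evalWord s ω' ∧ (∀ c ∈ ω', c ∈ S \ {b, b.inv}) ∧
        ∀ c, (ω'.count c : ℝ) ≤ K' c * f c := by
  have hN : 0 ≤ K b + K b.inv := add_nonneg (hK _) (hK _)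
  choose K₁ hK₁ h₁ using exists_count_conjStep_iterate_le b hK hN
  choose K₂ hK₂ h₂ using exists_count_conjStep_iterate_le b.inv hK hN
  refine ⟨fun c => K₁ c + K₂ c, fun c => add_nonneg (hK₁ c) (hK₂ c), fun f hf ω hωS hω => ?_⟩
  have hdeg : (deg b ω : ℝ) ≤ (K b + K b.inv) * f b := by
    have h1 : (deg b ω : ℝ) ≤ ω.count b + ω.count b.inv := by exact_mod_cast deg_le_count_add b ω
    have h2 := hω b
    have h3 := hω b.inv
    rw [hf.inv] at h3
    linarith
  obtain ⟨n, ω', hn, he, hc⟩ := exists_extract s b (deg b ω) ω le_rfl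
  set ω₀ := ω.filter fun x => !decide (x = b ∨ x = b.inv) with hω₀
  have hω₀S : ∀ c ∈ ω₀, c ∈ S \ {b, b.inv} := by
    intro c hc
    simp only [hω₀, List.mem_filter, Bool.not_eq_true', decide_eq_false_iff_not] at hc
    exact ⟨hωS c hc.1, hc.2⟩
  have hω₀K : ∀ c, (ω₀.count c : ℝ) ≤ K c * f c := fun c =>
    le_trans (by exact_mod_cast (List.filter_sublist).count_le c) (hω c)
  refine ⟨n, ω', ?_, he, fun c hcω => ?_, fun c => ?_⟩
  · refine le_trans ?_ hdeg
    exact_mod_cast hn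
  · have hpos : 0 < ω'.count c := List.count_pos_iff.2 hcω
    have := hc c
    by_cases h : 0 < ((conjStep b)^[deg b ω] ω₀).count c
    · exact mem_conjStep_iterate (fun x hx => hS.bracket_mem_diff hmin hx.1 hb) _ hω₀S c
        (List.count_pos_iff.1 h)
    · exact mem_conjStep_iterate (fun x hx => hS.bracket_mem_diff hmin hx.1 (hS.1 b hb)) _ hω₀S c
        (List.count_pos_iff.1 (by omega : 0 < ((conjStep b.inv)^[deg b ω] ω₀).count c))
  · have h1 := h₁ c f hf.bracket hf.nonneg ω₀ hω₀K (deg b ω) hdeg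
    have h2 := h₂ c f hf.bracket hf.nonneg ω₀ hω₀K (deg b ω) (by rwa [hf.inv])
    have h3 : (ω'.count c : ℝ) ≤ _ := Nat.cast_le.2 (hc c)
    push_cast at h3
    linarith

theorem evalWord_eq_one {s : Fin k → G} {ω : List (FormalComm k)}
    (h : ∀ c ∈ ω, c.eval s = 1) : evalWord s ω = 1 :=
  List.prod_eq_one (by simpa using h)

/-- Words with `O(f_c)` occurrences of each letter `c` are covered by boundedly many left
translates of the set of words of degree at most `f_c` in `c`. -/
theorem exists_cover (s : Fin k → G) {L : ℕ}
    (hL : ∀ c : FormalComm k, L < c.length → c.eval s = 1) (n : ℕ) :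
    ∀ S : Set (FormalComm k), IsBracketClosed S → {c ∈ S | c.length ≤ L}.ncard ≤ n →
    ∀ K : FormalComm k → ℝ, (∀ c, 0 ≤ K c) → ∃ M : ℕ, ∀ f, IsProfile f →
    ∃ A : Finset G, A.card ≤ M ∧ ∀ ω : List (FormalComm k), (∀ c ∈ ω, c ∈ S) →
      (∀ c, (ω.count c : ℝ) ≤ K c * f c) → ∃ a ∈ A, ∃ ω' : List (FormalComm k),
        (∀ c ∈ ω', c ∈ S) ∧ (∀ c, (deg c ω' : ℝ) ≤ f c) ∧ evalWord s ω = a * evalWord s ω' := by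
  classical
  have hfin (S : Set (FormalComm k)) : {c ∈ S | c.length ≤ L}.Finite :=
    (finite_length_le L).subset fun c hc => hc.2
  -- The induction is on the number of commutators of length at most L left in S; when there are
  -- none, every word evaluates to 1.
  induction n with
  | zero =>
    intro S hS hn K hK
    refine ⟨1, fun f hf => ⟨{1}, by simp, fun ω hω _ => ⟨1, by simp, [], by simp, fun c => ?_, ?_⟩⟩⟩
    · simpa [deg] using hf.nonneg c
    · rw [evalWord_eq_one (fun c hc => hL c ?_)]
      · simp [evalWord]
      · by_contra h
        have hemp := (Set.ncard_eq_zero (hfin S)).1 (Nat.le_zero.1 hn)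
        exact Set.notMem_empty c (hemp ▸ (⟨hω c hc, not_lt.1 h⟩ : c ∈ {c ∈ S | c.length ≤ L}))
  | succ n ih =>
    intro S hS hn K hK
    by_cases hemp : {c ∈ S | c.length ≤ L} = ∅
    · exact ih S hS (by simp [hemp]) K hK
    obtain ⟨b₀, hb₀⟩ := Set.nonempty_iff_ne_empty.2 hemp
    obtain ⟨b, hb, hmin⟩ : ∃ b ∈ S, ∀ c ∈ S, b.length ≤ c.length := by
      obtain ⟨b, hb, h⟩ := (measure (length (k := k))).wf.has_min S ⟨b₀, hb₀.1⟩
      exact ⟨b, hb, fun c hc => not_lt.1 (h c hc)⟩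
    have hS' := hS.diff hmin
    have hcard : {c ∈ S \ {b, b.inv} | c.length ≤ L}.ncard ≤ n := by
      have hlt : {c ∈ S \ {b, b.inv} | c.length ≤ L}.ncard < {c ∈ S | c.length ≤ L}.ncard := by
        refine Set.ncard_lt_ncard ⟨fun c hc => ⟨hc.1.1, hc.2⟩, fun h => ?_⟩ (hfin S)
        exact (h (⟨hb, (hmin _ hb₀.1).trans hb₀.2⟩ : b ∈ {c ∈ S | c.length ≤ L})).1.2 (Or.inl rfl)
      omega
    obtain ⟨K₁, hK₁, h₁⟩ := exists_extract_bound s hS hb hmin hK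
    choose K₂ hK₂ h₂ using exists_count_conjStep_iterate_le b.inv hK₁ zero_le_one
    obtain ⟨M, hM⟩ := ih _ hS' hcard K₂ hK₂
    have hQ0 : 0 ≤ K b + K b.inv := add_nonneg (hK _) (hK _)
    -- With m = ⌊f_b⌋, an exponent z = O(f_b) has quotient |z / m| ≤ Q: the factor 2 comes from f_b
    -- ≤ 2m and the extra 1 from the remainder. The powers b^(mq), |q| ≤ Q, are the new translates.
    set Q : ℕ := ⌈2 * (K b + K b.inv)⌉₊ + 1 with hQ
    refine ⟨(2 * Q + 1) * M, fun f hf => ?_⟩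
    obtain ⟨A, hA, hcov⟩ := hM f hf
    set m : ℕ := ⌊f b⌋₊ with hm
    have hm1 : 1 ≤ m := Nat.le_floor (by simpa using hf.one_le b)
    have hmf : (m : ℝ) ≤ f b := Nat.floor_le (hf.nonneg b)
    have hfm : f b ≤ 2 * m := by
      have h1 : f b < m + 1 := Nat.lt_floor_add_one _
      have h2 : (1 : ℝ) ≤ m := by exact_mod_cast hm1
      linarith
    refine ⟨Finset.image₂ (fun (q : ℤ) a => b.eval s ^ ((m : ℤ) * q) * a)
      (Finset.Icc (-(Q : ℤ)) Q) A, ?_, fun ω hωS hω => ?_⟩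
    · refine (Finset.card_image₂_le _ _ _).trans (Nat.mul_le_mul ?_ hA)
      simp only [Int.card_Icc]
      omega
    obtain ⟨z, ω₁, hz, he, hω₁S, hω₁⟩ := h₁ f hf ω hωS hω
    set r : ℕ := (z % m).toNat with hr
    have hm0 : (0 : ℤ) < m := by exact_mod_cast hm1
    have hr' : (r : ℤ) = z % m := Int.toNat_of_nonneg (Int.emod_nonneg _ hm0.ne')
    have hrm : r < m := by
      have := Int.emod_lt_of_pos z hm0
      omega
    have hrm' : (r : ℝ) ≤ f b := le_trans (by exact_mod_cast hrm.le) hmf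
    have hzd : z = m * (z / m) + r := by rw [hr']; exact (Int.mul_ediv_add_emod z m).symm
    -- The remainder is moved to the right end, b^r ω₁ = (b^r ω₁ b^{-r}) b^r, so that the induction
    -- hypothesis applies to a word free of b^{±1} and its translate a stays on the left.
    obtain ⟨a, ha, ω₂, hω₂S, hω₂, he₂⟩ := hcov ((conjStep b.inv)^[r] ω₁)
      (mem_conjStep_iterate (fun x hx => hS.bracket_mem_diff hmin hx.1 (hS.1 b hb)) _ hω₁S)
      (fun c => h₂ c f hf.bracket hf.nonneg ω₁ hω₁ r (by rw [hf.inv, one_mul]; exact hrm'))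
    refine ⟨b.eval s ^ ((m : ℤ) * (z / m)) * a, Finset.mem_image₂.2 ⟨z / m, ?_, a, ha, rfl⟩,
      ω₂ ++ List.replicate r b, ?_, fun c => ?_, ?_⟩
    · have h1 : |((z / m : ℤ) : ℝ)| ≤ Q := by
        have hmR : (0 : ℝ) < m := by exact_mod_cast hm1
        have h2 : (m : ℝ) * |((z / m : ℤ) : ℝ)| ≤ |(z : ℝ)| + r := by
          have h3 : (m : ℝ) * ((z / m : ℤ) : ℝ) = z - r := by
            have : (z : ℝ) = m * ((z / m : ℤ) : ℝ) + r := by exact_mod_cast hzd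
            linarith
          have h4 : (m : ℝ) * |((z / m : ℤ) : ℝ)| = |(z : ℝ) - r| := by
            rw [← h3, abs_mul, abs_of_pos hmR]
          rw [h4]
          refine (abs_sub _ _).trans (le_of_eq ?_)
          rw [abs_of_nonneg (Nat.cast_nonneg r : (0 : ℝ) ≤ r)]
        have h5 : (r : ℝ) ≤ m := by exact_mod_cast hrm.le
        have h6 : (K b + K b.inv) * f b ≤ (K b + K b.inv) * (2 * m) :=
          mul_le_mul_of_nonneg_left hfm hQ0
        have h7 : 2 * (K b + K b.inv) + 1 ≤ Q := by
          rw [hQ]; push_cast; linarith [Nat.le_ceil (2 * (K b + K b.inv))]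
        have h8 : (m : ℝ) * |((z / m : ℤ) : ℝ)| ≤ m * Q := by nlinarith
        exact le_of_mul_le_mul_left h8 hmR
      rw [Finset.mem_Icc, ← abs_le]
      exact_mod_cast h1
    · intro c hc
      rcases List.mem_append.1 hc with hc | hc
      · exact (hω₂S c hc).1
      · rw [List.eq_of_mem_replicate hc]; exact hb
    · rw [deg_append]
      -- No b^{±1} occurs in ω₂, so the degree in b is at most r ≤ f_b, with constant exactly 1; the
      -- other degrees come from ω₂ alone.
      by_cases hcb : b = c ∨ b = c.inv
      · have h0 : deg c ω₂ = 0 := by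
          by_contra h
          obtain ⟨x, hx, hxc⟩ := (deg_pos_iff c ω₂).1 (Nat.pos_of_ne_zero h)
          refine (hω₂S x hx).2 ?_
          rcases hcb with rfl | rfl
          · exact hxc
          · rw [Set.mem_insert_iff, Set.mem_singleton_iff, FormalComm.inv_inv]
            exact hxc.symm
        have h1 : (deg c (List.replicate r b) : ℝ) ≤ r := by
          exact_mod_cast (deg_le_length c _).trans_eq (List.length_replicate)
        have h2 : f c = f b := by rcases hcb with rfl | rfl <;> simp [hf.inv]
        rw [h0, h2, zero_add]
        exact h1.trans hrm'
      · have h0 : deg c (List.replicate r b) = 0 := by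
          by_contra h
          obtain ⟨x, hx, hxc⟩ := (deg_pos_iff c _).1 (Nat.pos_of_ne_zero h)
          rw [List.eq_of_mem_replicate hx] at hxc
          exact hcb hxc
        rw [h0, add_zero]
        exact hω₂ c
    · rw [evalWord_conjStep_iterate, eval_inv] at he₂
      have h1 : evalWord s ω₁ = (b.eval s ^ r)⁻¹ * (a * evalWord s ω₂) * b.eval s ^ r := by
        rw [← he₂]; simp [mul_assoc]
      have h2 : b.eval s ^ z = b.eval s ^ ((m : ℤ) * (z / m)) * b.eval s ^ r := by
        rw [← zpow_natCast (b.eval s) r, ← zpow_add, ← hzd]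
      rw [he, h1, h2, evalWord_append, evalWord_replicate]
      group

/-- Letters longer than L evaluate to 1 and can be deleted; what remains is a word of bounded length
over a finite alphabet. -/
theorem finite_evalWord (s : Fin k → G) {L : ℕ}
    (hL : ∀ c : FormalComm k, L < c.length → c.eval s = 1) (K : FormalComm k → ℝ) :
    {g | ∃ ω : List (FormalComm k), evalWord s ω = g ∧ ∀ c, (ω.count c : ℝ) ≤ K c}.Finite := by
  classical
  set T := (finite_length_le (k := k) L).toFinset with hT
  have := (List.finite_length_le T (∑ c ∈ T, ⌊K c⌋₊)).image
    fun l => evalWord s (l.map Subtype.val)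
  refine this.subset ?_
  rintro g ⟨ω, rfl, hω⟩
  have hmem : ∀ c ∈ ω.filter (fun c => c ∈ T), c ∈ T := fun c hc => by
    simpa using (List.mem_filter.1 hc).2
  refine ⟨(ω.filter (fun c => c ∈ T)).attach.map fun c => ⟨c.1, hmem c.1 c.2⟩, ?_, ?_⟩
  · simp only [Set.mem_ofPred_eq, List.length_map, List.length_attach]
    rw [← Multiset.coe_card, ← Multiset.sum_count_eq_card (s := T) (by simp)]
    refine Finset.sum_le_sum fun c _ => ?_
    rw [Multiset.coe_count]
    exact Nat.le_floor (le_trans (by exact_mod_cast (List.filter_sublist).count_le c) (hω c))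
  · simp only [List.map_map, Function.comp_def]
    clear hω hmem
    induction ω with
    | nil => rfl
    | cons x t ih =>
      by_cases hx : x ∈ T
      · rw [List.filter_cons_of_pos (by simpa using hx)]
        simpa [evalWord] using ih
      · rw [List.filter_cons_of_neg (by simpa using hx), ih]
        have : L < x.length := by simpa [hT] using hx
        simp [evalWord, hL x this]

end Words
end NilWalk

/-! ### Growth of weight functions and generalized inverses -/

namespace NilWalk
open FormalComm

section WeightFunctions

variable {k : ℕ} {F : Fin k → ℝ → ℝ}

theorem isProfile_weightFun (hF : ∀ i, IsIncreasing (F i)) {r : ℝ} (hr : 1 ≤ r) :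
    IsProfile fun c => c.weightFun F r where
  bracket _ _ := rfl
  one_le c := by
    induction c with
    | letter i b => exact (hF i).2 r hr
    | bracket x y hx hy => exact one_le_mul_of_one_le_of_one_le hx hy
  inv c := weightFun_inv F c r

theorem one_le_weightFun (hF : ∀ i, IsIncreasing (F i)) (c : FormalComm k) {r : ℝ} (hr : 1 ≤ r) :
    1 ≤ c.weightFun F r := (isProfile_weightFun hF hr).one_le c

theorem weightFun_mono (hF : ∀ i, IsIncreasing (F i)) (c : FormalComm k) {r r' : ℝ} (hr : 1 ≤ r)
    (h : r ≤ r') : c.weightFun F r ≤ c.weightFun F r' := by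
  induction c with
  | letter i b => exact (hF i).1 hr (hr.trans h) h
  | bracket x y hx hy =>
    exact mul_le_mul hx hy (zero_le_one.trans (one_le_weightFun hF y hr))
      (zero_le_one.trans (one_le_weightFun hF x (hr.trans h)))

/-- The dilation a serves all c at once, since a product grows at least as fast as one of its
factors. In `exists_weightFun_mul_le`, by contrast, the constant is multiplied along brackets and
depends on c. -/
theorem exists_mul_weightFun_le (hF : ∀ i, IsIncreasing (F i)) (hF1 : IsDoublingSystem F) (K : ℝ) :
    ∃ a, 1 ≤ a ∧ ∀ (c : FormalComm k) (r : ℝ), 1 ≤ r →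
      K * c.weightFun F r ≤ c.weightFun F (a * r) := by
  obtain ⟨C, hC, h⟩ := hF1
  have one (c : FormalComm k) {r : ℝ} (hr : 1 ≤ r) :
      2 * c.weightFun F r ≤ c.weightFun F (C * r) := by
    have hCr : 1 ≤ C * r := one_le_mul_of_one_le_of_one_le hC hr
    induction c with
    | letter i b => exact (h i r hr).1
    | bracket x y hx hy =>
      have h1 := one_le_weightFun hF x hr
      have h2 := one_le_weightFun hF y hr
      simp only [weightFun]
      nlinarith [mul_le_mul hx hy (by linarith) (by linarith)]
  have pow (n : ℕ) (c : FormalComm k) {r : ℝ} (hr : 1 ≤ r) :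
      2 ^ n * c.weightFun F r ≤ c.weightFun F (C ^ n * r) := by
    induction n with
    | zero => simp
    | succ n ih =>
      have h1 : 1 ≤ C ^ n * r := one_le_mul_of_one_le_of_one_le (one_le_pow₀ hC) hr
      have h2 := one c h1
      calc 2 ^ (n + 1) * c.weightFun F r = 2 * (2 ^ n * c.weightFun F r) := by ring
        _ ≤ 2 * c.weightFun F (C ^ n * r) := by linarith
        _ ≤ _ := h2
        _ = _ := by ring_nf
  obtain ⟨n, hn⟩ := pow_unbounded_of_one_lt K (one_lt_two : (1 : ℝ) < 2)
  refine ⟨C ^ n, one_le_pow₀ hC, fun c r hr => le_trans ?_ (pow n c hr)⟩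
  exact mul_le_mul_of_nonneg_right hn.le (zero_le_one.trans (one_le_weightFun hF c hr))

theorem exists_weightFun_mul_le (hF : ∀ i, IsIncreasing (F i)) (hF1 : IsDoublingSystem F)
    (c : FormalComm k) (a : ℝ) :
    ∃ K, 1 ≤ K ∧ ∀ r, 1 ≤ r → 1 ≤ a * r → c.weightFun F (a * r) ≤ K * c.weightFun F r := by
  obtain ⟨C, hC, h⟩ := hF1
  have one (c : FormalComm k) :
      ∃ K, 1 ≤ K ∧ ∀ r, 1 ≤ r → c.weightFun F (2 * r) ≤ K * c.weightFun F r := by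
    induction c with
    | letter i b => exact ⟨C, hC, fun r hr => (h i r hr).2⟩
    | bracket x y hx hy =>
      obtain ⟨K, hK, hx⟩ := hx
      obtain ⟨K', hK', hy⟩ := hy
      refine ⟨K * K', one_le_mul_of_one_le_of_one_le hK hK', fun r hr => ?_⟩
      have h1 := one_le_weightFun hF x hr
      have h2 := one_le_weightFun hF y (r := 2 * r) (by linarith)
      calc x.weightFun F (2 * r) * y.weightFun F (2 * r)
          ≤ (K * x.weightFun F r) * (K' * y.weightFun F r) :=
            mul_le_mul (hx r hr) (hy r hr) (by linarith) (by nlinarith)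
        _ = _ := by simp only [weightFun]; ring
  obtain ⟨K, hK, h1⟩ := one c
  have pow (n : ℕ) {r : ℝ} (hr : 1 ≤ r) : c.weightFun F (2 ^ n * r) ≤ K ^ n * c.weightFun F r := by
    induction n with
    | zero => simp
    | succ n ih =>
      have h2 : 1 ≤ 2 ^ n * r := one_le_mul_of_one_le_of_one_le (one_le_pow₀ one_le_two) hr
      calc c.weightFun F (2 ^ (n + 1) * r) = c.weightFun F (2 * (2 ^ n * r)) := by ring_nf
        _ ≤ K * c.weightFun F (2 ^ n * r) := h1 _ h2
        _ ≤ K * (K ^ n * c.weightFun F r) := mul_le_mul_of_nonneg_left ih (by linarith)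
        _ = _ := by ring
  obtain ⟨n, hn⟩ := pow_unbounded_of_one_lt a (one_lt_two : (1 : ℝ) < 2)
  exact ⟨K ^ n, one_le_pow₀ hK, fun r hr har =>
    (weightFun_mono hF c har (mul_le_mul_of_nonneg_right hn.le (by linarith))).trans (pow n hr)⟩

theorem exists_le_weightFun (hF : ∀ i, IsIncreasing (F i)) (hF1 : IsDoublingSystem F) (K : ℝ) :
    ∃ a, 1 ≤ a ∧ ∀ c : FormalComm k, K ≤ c.weightFun F a := by
  obtain ⟨a, ha, h⟩ := exists_mul_weightFun_le hF hF1 |K|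
  refine ⟨a, ha, fun c => ?_⟩
  have h1 := h c 1 le_rfl
  have h2 := one_le_weightFun hF c (le_refl 1)
  rw [mul_one] at h1
  nlinarith [le_abs_self K, abs_nonneg K]

/-- The hypothesis excludes the default value `sInf ∅ = 0`. -/
theorem one_le_genInv {f : ℝ → ℝ} {t : ℝ} (h : ∃ r, 1 ≤ r ∧ t ≤ f r) : 1 ≤ genInv f t :=
  le_csInf h fun _ hr => hr.1

theorem genInv_le {f : ℝ → ℝ} {r t : ℝ} (hr : 1 ≤ r) (h : t ≤ f r) : genInv f t ≤ r :=
  csInf_le ⟨1, fun _ hr => hr.1⟩ ⟨hr, h⟩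

theorem le_genInv {f : ℝ → ℝ} (hf : MonotoneOn f (Set.Ici 1)) {r t : ℝ}
    (ht : ∃ r, 1 ≤ r ∧ t ≤ f r) (hr : 1 ≤ r) (h : f r < t) : r ≤ genInv f t := by
  refine le_csInf ht fun r' hr' => ?_
  by_contra hlt
  exact absurd (hr'.2.trans (hf hr'.1 hr (not_le.1 hlt).le)) (not_le.2 h)

/-- The inequality is strict because f may jump and the infimum need not be attained. -/
theorem le_of_genInv_lt {f : ℝ → ℝ} (hf : MonotoneOn f (Set.Ici 1)) {r t : ℝ}
    (ht : ∃ r, 1 ≤ r ∧ t ≤ f r) (h : genInv f t < r) : t ≤ f r := by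
  obtain ⟨r', ⟨h1, h2⟩, h3⟩ := exists_lt_of_csInf_lt ht h
  exact h2.trans (hf h1 (h1.trans h3.le) h3.le)

theorem lt_of_lt_genInv {f : ℝ → ℝ} {r t : ℝ} (hr : 1 ≤ r) (h : r < genInv f t) : f r < t := by
  by_contra hle
  exact absurd (genInv_le hr (not_lt.1 hle)) (not_le.2 h)

end WeightFunctions

/-! ### Commutator balls, the quasi-norm and volume doubling -/

section CommutatorBalls

variable {G : Type*} [Group G] {k : ℕ} {s : Fin k → G} {F : Fin k → ℝ → ℝ}

/-- The elements represented by words of degree at most `F_c(ρ)` in every `c`. -/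
def comBall (s : Fin k → G) (F : Fin k → ℝ → ℝ) (ρ : ℝ) : Set G :=
  {g | ∃ ω : List (FormalComm k), evalWord s ω = g ∧ ∀ c, (deg c ω : ℝ) ≤ c.weightFun F ρ}

theorem comBall_mono (hF : ∀ i, IsIncreasing (F i)) {ρ ρ' : ℝ} (hρ : 1 ≤ ρ) (h : ρ ≤ ρ') :
    comBall s F ρ ⊆ comBall s F ρ' := by
  rintro g ⟨ω, hω, hd⟩
  exact ⟨ω, hω, fun c => (hd c).trans (weightFun_mono hF c hρ h)⟩

theorem one_mem_comBall (hF : ∀ i, IsIncreasing (F i)) {ρ : ℝ} (hρ : 1 ≤ ρ) :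
    (1 : G) ∈ comBall s F ρ :=
  ⟨[], by simp [evalWord], fun c => by simpa [deg] using (isProfile_weightFun hF hρ).nonneg c⟩

theorem letter_mem_comBall (hF : ∀ i, IsIncreasing (F i)) (i : Fin k) {ρ : ℝ} (hρ : 1 ≤ ρ) :
    s i ∈ comBall s F ρ :=
  ⟨[.letter i true], by simp [evalWord, eval], fun c =>
    le_trans (by exact_mod_cast deg_le_length c _) (one_le_weightFun hF c hρ)⟩

theorem inv_mem_comBall {ρ : ℝ} {g : G} (hg : g ∈ comBall s F ρ) : g⁻¹ ∈ comBall s F ρ := by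
  obtain ⟨ω, rfl, hd⟩ := hg
  exact ⟨ω.reverse.map FormalComm.inv, evalWord_reverse_inv s ω, fun c => by
    rw [deg_reverse_inv]; exact hd c⟩

theorem exists_mul_mem_comBall (hF : ∀ i, IsIncreasing (F i)) (hF1 : IsDoublingSystem F) :
    ∃ a, 1 ≤ a ∧ ∀ ρ, 1 ≤ ρ → ∀ g ∈ comBall s F ρ, ∀ h ∈ comBall s F ρ,
      g * h ∈ comBall s F (a * ρ) := by
  obtain ⟨a, ha, h2⟩ := exists_mul_weightFun_le hF hF1 2
  refine ⟨a, ha, ?_⟩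
  rintro ρ hρ _ ⟨ω, rfl, hω⟩ _ ⟨ω', rfl, hω'⟩
  refine ⟨ω ++ ω', evalWord_append s ω ω', fun c => le_trans ?_ (h2 c ρ hρ)⟩
  rw [deg_append]
  push_cast
  linarith [hω c, hω' c]

theorem finite_comBall [Group.IsNilpotent G] (ρ : ℝ) : (comBall s F ρ).Finite := by
  obtain ⟨L, hL⟩ := exists_length_eval_eq_one s
  refine (finite_evalWord s hL fun c => c.weightFun F ρ).subset ?_
  rintro g ⟨ω, hω, hd⟩
  exact ⟨ω, hω, fun c => le_trans (by exact_mod_cast count_le_deg c ω) (hd c)⟩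

theorem exists_evalWord_eq (hs : Subgroup.closure (Set.range s) = ⊤) (g : G) :
    ∃ ω : List (FormalComm k), evalWord s ω = g := by
  have hg : g ∈ Subgroup.closure (Set.range s) := hs ▸ Subgroup.mem_top g
  induction hg using Subgroup.closure_induction with
  | mem x hx =>
    obtain ⟨i, rfl⟩ := hx
    exact ⟨[.letter i true], by simp [evalWord, eval]⟩
  | one => exact ⟨[], by simp [evalWord]⟩
  | mul x y _ _ hx hy =>
    obtain ⟨ω, rfl⟩ := hx
    obtain ⟨ω', rfl⟩ := hy
    exact ⟨ω ++ ω', evalWord_append s ω ω'⟩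
  | inv x _ hx =>
    obtain ⟨ω, rfl⟩ := hx
    exact ⟨_, evalWord_reverse_inv s ω⟩

theorem exists_mem_comBall (hs : Subgroup.closure (Set.range s) = ⊤)
    (hF : ∀ i, IsIncreasing (F i)) (hF1 : IsDoublingSystem F) (g : G) :
    ∃ ρ, 1 ≤ ρ ∧ g ∈ comBall s F ρ := by
  obtain ⟨ω, rfl⟩ := exists_evalWord_eq hs g
  obtain ⟨ρ, hρ, h⟩ := exists_le_weightFun hF hF1 ω.length
  exact ⟨ρ, hρ, ω, rfl, fun c => le_trans (by exact_mod_cast deg_le_length c ω) (h c)⟩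

/-- Volume doubling: F_c(aρ) ≤ K_c F_c(ρ), so B(aρ) is covered by M translates of B(ρ). M is uniform
in ρ because `exists_cover` is uniform over profiles. -/
theorem exists_ncard_comBall_le [Group.IsNilpotent G] (hF : ∀ i, IsIncreasing (F i))
    (hF1 : IsDoublingSystem F) (a : ℝ) (ha : 1 ≤ a) :
    ∃ M : ℕ, ∀ ρ, 1 ≤ ρ → (comBall s F (a * ρ)).ncard ≤ M * (comBall s F ρ).ncard := by
  obtain ⟨L, hL⟩ := exists_length_eval_eq_one s
  choose K hK1 hK using fun c => exists_weightFun_mul_le hF hF1 c a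
  obtain ⟨M, hM⟩ := exists_cover s hL _ Set.univ
    ⟨fun _ _ => trivial, fun _ _ _ _ => trivial⟩ le_rfl K (fun c => zero_le_one.trans (hK1 c))
  refine ⟨M, fun ρ hρ => ?_⟩
  obtain ⟨A, hA, hcov⟩ := hM _ (isProfile_weightFun hF hρ)
  have hsub : comBall s F (a * ρ) ⊆ Set.image2 (fun x y => x * y) (A : Set G) (comBall s F ρ) := by
    rintro g ⟨ω, rfl, hd⟩
    obtain ⟨x, hx, ω', -, hd', he⟩ := hcov ω (fun _ _ => trivial) fun c =>
      le_trans (by exact_mod_cast count_le_deg c ω) ((hd c).trans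
        (hK c ρ hρ (one_le_mul_of_one_le_of_one_le ha hρ)))
    exact ⟨x, hx, evalWord s ω', ⟨ω', rfl, hd'⟩, he.symm⟩
  have hfin := (finite_comBall (s := s) (F := F) ρ)
  refine (Set.ncard_le_ncard hsub (A.finite_toSet.image2 _ hfin)).trans ?_
  rw [← Set.image_uncurry_prod]
  refine (Set.ncard_image_le (A.finite_toSet.prod hfin)).trans ?_
  rw [Set.ncard_prod, Set.ncard_coe_finset]
  exact Nat.mul_le_mul_right _ hA

theorem ncard_comBall_pos [Group.IsNilpotent G] (hF : ∀ i, IsIncreasing (F i)) {ρ : ℝ}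
    (hρ : 1 ≤ ρ) : 0 < (comBall s F ρ).ncard :=
  (Set.ncard_pos (finite_comBall ρ)).2 ⟨1, one_mem_comBall hF hρ⟩

theorem comNorm_nonneg (c₀ : FormalComm k) (g : G) : 0 ≤ comNorm s F c₀ g := by
  unfold comNorm
  split_ifs
  · exact le_rfl
  · exact Real.sInf_nonneg fun r hr => zero_le_one.trans hr.1

theorem comNorm_inv (c₀ : FormalComm k) (g : G) : comNorm s F c₀ g⁻¹ = comNorm s F c₀ g := by
  have h : ∀ (x : G) (ρ : ℝ), x⁻¹ ∈ comBall s F ρ ↔ x ∈ comBall s F ρ := fun x ρ =>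
    ⟨fun h => by simpa using inv_mem_comBall h, inv_mem_comBall⟩
  have h' := fun ρ => h g ρ
  simp only [comBall, Set.mem_ofPred_eq] at h'
  unfold comNorm
  by_cases hg : g = 1
  · simp [hg]
  · simp only [inv_eq_one, hg, h', if_false]

/-- F_{c₀} may be locally constant, so its inverse at F_{c₀}(ρ) can fall below ρ. Passing to aρ,
where F_{c₀} has at least doubled, repairs this. The word in the conclusion also shows that the
infimum defining the norm is over a nonempty set. -/
theorem exists_comNorm_le (hF : ∀ i, IsIncreasing (F i)) (hF1 : IsDoublingSystem F)
    (c₀ : FormalComm k) : ∃ a, 1 ≤ a ∧ ∀ ρ, 1 ≤ ρ → ∀ g ∈ comBall s F ρ,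
      (∃ ω : List (FormalComm k), evalWord s ω = g ∧ ∀ c, (deg c ω : ℝ) ≤
        c.weightFun F (genInv (c₀.weightFun F) (c₀.weightFun F (a * ρ)))) ∧
      comNorm s F c₀ g ≤ c₀.weightFun F (a * ρ) := by
  obtain ⟨a, ha, h2⟩ := exists_mul_weightFun_le hF hF1 2
  refine ⟨a, ha, ?_⟩
  rintro ρ hρ g ⟨ω, hω, hd⟩
  have haρ : 1 ≤ a * ρ := one_le_mul_of_one_le_of_one_le ha hρ
  have key : ρ ≤ genInv (c₀.weightFun F) (c₀.weightFun F (a * ρ)) := by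
    refine le_genInv (fun x hx y _ hxy => weightFun_mono hF c₀ hx hxy) ⟨_, haρ, le_rfl⟩ hρ ?_
    have := one_le_weightFun hF c₀ hρ
    linarith [h2 c₀ ρ hρ]
  have mem : ∃ ω : List (FormalComm k), evalWord s ω = g ∧ ∀ c, (deg c ω : ℝ) ≤
        c.weightFun F (genInv (c₀.weightFun F) (c₀.weightFun F (a * ρ))) :=
    ⟨ω, hω, fun c => (hd c).trans (weightFun_mono hF c hρ key)⟩
  refine ⟨mem, ?_⟩
  unfold comNorm
  have h1 := one_le_weightFun hF c₀ haρ
  split_ifs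
  · linarith
  · exact csInf_le ⟨1, fun r hr => hr.1⟩ ⟨h1, mem⟩

/-- The strict inequality supplies an admissible radius below F_{c₀}(ρ), although the infimum itself
need not be admissible. -/
theorem mem_comBall_of_comNorm_lt (hs : Subgroup.closure (Set.range s) = ⊤)
    (hF : ∀ i, IsIncreasing (F i)) (hF1 : IsDoublingSystem F)
    (c₀ : FormalComm k) {ρ : ℝ} (hρ : 1 ≤ ρ) {g : G}
    (hg : comNorm s F c₀ g < c₀.weightFun F ρ) : g ∈ comBall s F ρ := by
  by_cases h1 : g = 1
  · rw [h1]; exact one_mem_comBall hF hρ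
  unfold comNorm at hg
  rw [if_neg h1] at hg
  obtain ⟨a, ha, h⟩ := exists_comNorm_le (s := s) hF hF1 c₀
  obtain ⟨ρ', hρ', hg'⟩ := exists_mem_comBall hs hF hF1 g
  have haρ : 1 ≤ a * ρ' := one_le_mul_of_one_le_of_one_le ha hρ'
  have hne : {r | 1 ≤ r ∧ ∃ ω : List (FormalComm k), evalWord s ω = g ∧
      ∀ c, (deg c ω : ℝ) ≤ c.weightFun F (genInv (c₀.weightFun F) r)}.Nonempty :=
    ⟨_, one_le_weightFun hF c₀ haρ, (h ρ' hρ' g hg').1⟩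
  obtain ⟨r, ⟨hr1, ω, hω, hd⟩, hr⟩ := exists_lt_of_csInf_lt hne hg
  exact ⟨ω, hω, fun c => (hd c).trans (weightFun_mono hF c (one_le_genInv ⟨ρ, hρ, hr.le⟩)
    (genInv_le hρ hr.le))⟩

theorem finite_comNorm_le [Group.IsNilpotent G] (hs : Subgroup.closure (Set.range s) = ⊤)
    (hF : ∀ i, IsIncreasing (F i)) (hF1 : IsDoublingSystem F)
    (c₀ : FormalComm k) (r : ℝ) : {g : G | comNorm s F c₀ g ≤ r}.Finite := by
  obtain ⟨a, ha, h⟩ := exists_le_weightFun (k := k) hF hF1 (r + 1)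
  refine (finite_comBall (s := s) (F := F) a).subset fun g hg => ?_
  refine mem_comBall_of_comNorm_lt hs hF hF1 c₀ ha (lt_of_le_of_lt hg ?_)
  linarith [h c₀]

theorem volumeFun_comNorm_pos [Group.IsNilpotent G] (hs : Subgroup.closure (Set.range s) = ⊤)
    (hF : ∀ i, IsIncreasing (F i)) (hF1 : IsDoublingSystem F)
    (c₀ : FormalComm k) (g : G) : 0 < volumeFun (comNorm s F c₀) (comNorm s F c₀ g) := by
  have : 0 < {x : G | comNorm s F c₀ x ≤ comNorm s F c₀ g}.ncard :=
    (Set.ncard_pos (finite_comNorm_le hs hF hF1 c₀ _)).2 ⟨g, le_refl (comNorm s F c₀ g)⟩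
  exact Nat.cast_pos.2 this

theorem zpow_eq_evalWord_mul (g : G) {u : ℕ} {ω : List (FormalComm k)} (h : evalWord s ω = g ^ u)
    (q r : ℕ) : evalWord s ((List.replicate q ω).flatten) * g ^ r = g ^ (u * q + r) := by
  have : evalWord s ((List.replicate q ω).flatten) = (g ^ u) ^ q := by
    induction q with
    | zero => simp [evalWord]
    | succ q ih =>
      rw [List.replicate_succ, List.flatten_cons, evalWord_append, ih, h, pow_succ']
  rw [this, pow_add, pow_mul]

/-- If some power of `g` is a product of commutators `c` with `F_c` at least of the order of
`f`, then `g ^ n` is at distance `O(f⁻¹(n))`. -/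
theorem exists_zpow_mem_comBall (hF : ∀ i, IsIncreasing (F i)) (hF1 : IsDoublingSystem F)
    {f : ℝ → ℝ} {i : Fin k} {u : ℕ} (hu : 1 ≤ u)
    {ω : List (FormalComm k)} (h : evalWord s ω = s i ^ u) {C : ℝ}
    (hω : ∀ c ∈ ω, ∀ r, 1 ≤ r → f r ≤ C * c.weightFun F r) :
    ∃ a, 1 ≤ a ∧ ∀ ρ, 1 ≤ ρ → ∀ n : ℤ, |(n : ℝ)| ≤ f ρ → s i ^ n ∈ comBall s F (a * ρ) := by
  -- With n = uq + r, s_i^n is q copies of ω followed by r < u letters. Each letter x of ω has q ≤ n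
  -- ≤ f(ρ) ≤ C F_x(ρ), so the first part has degree at most |ω| |C| F_c(ρ), the second at most u.
  obtain ⟨a, ha, hK⟩ := exists_mul_weightFun_le hF hF1 (ω.length * |C| + u)
  refine ⟨a, ha, fun ρ hρ => ?_⟩
  have main : ∀ n : ℕ, (n : ℝ) ≤ f ρ → s i ^ n ∈ comBall s F (a * ρ) := by
    intro n hn
    refine ⟨(List.replicate (n / u) ω).flatten ++ List.replicate (n % u) (.letter i true),
      ?_, fun c => ?_⟩
    · rw [evalWord_append, evalWord_replicate]
      conv_rhs => rw [← Nat.div_add_mod n u]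
      exact zpow_eq_evalWord_mul (s i) h _ _
    · refine le_trans ?_ (hK c ρ hρ)
      have h1 := one_le_weightFun hF c hρ
      have hdeg : deg c ((List.replicate (n / u) ω).flatten) = (n / u) * deg c ω := by
        generalize n / u = q
        induction q with
        | zero => simp [deg]
        | succ q ih => rw [List.replicate_succ, List.flatten_cons, deg_append, ih]; ring
      have h2 : (deg c (List.replicate (n % u) (FormalComm.letter i true)) : ℝ) ≤ u := by
        have := deg_le_length c (List.replicate (n % u) (FormalComm.letter i true))
        rw [List.length_replicate] at this
        exact_mod_cast this.trans (Nat.mod_lt n hu).le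
      have h3 : ((n / u : ℕ) * deg c ω : ℝ) ≤ ω.length * |C| * c.weightFun F ρ := by
        by_cases hd : 0 < deg c ω
        · obtain ⟨x, hx, hxc⟩ := (deg_pos_iff c ω).1 hd
          have hxF : x.weightFun F ρ = c.weightFun F ρ := by
            rcases hxc with rfl | rfl
            · rfl
            · exact weightFun_inv F c ρ
          have h4 : ((n / u : ℕ) : ℝ) ≤ n := by exact_mod_cast Nat.div_le_self n u
          have h5 : ((n / u : ℕ) : ℝ) ≤ |C| * c.weightFun F ρ := by
            refine (h4.trans (hn.trans (hω x hx ρ hρ))).trans ?_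
            rw [hxF]
            exact mul_le_mul_of_nonneg_right (le_abs_self C) (by linarith)
          have h6 : (deg c ω : ℝ) ≤ ω.length := by exact_mod_cast deg_le_length c ω
          calc ((n / u : ℕ) * deg c ω : ℝ) ≤ (|C| * c.weightFun F ρ) * ω.length :=
                mul_le_mul h5 h6 (Nat.cast_nonneg _) (by positivity)
            _ = _ := by ring
        · rw [Nat.eq_zero_of_not_pos hd]
          have := abs_nonneg C
          simp only [Nat.cast_zero, mul_zero]
          positivity
      rw [deg_append, hdeg]
      push_cast
      have h4 : (u : ℝ) ≤ u * c.weightFun F ρ := le_mul_of_one_le_right (Nat.cast_nonneg u) h1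
      linarith
  intro n hn
  have habs : ((n.natAbs : ℕ) : ℝ) = |(n : ℝ)| := by
    rw [Nat.cast_natAbs, Int.cast_abs]
  have := main n.natAbs (by rw [habs]; exact hn)
  rcases Int.natAbs_eq n with h | h
  · rw [h, zpow_natCast]; exact this
  · rw [h, zpow_neg, zpow_natCast]; exact inv_mem_comBall this

end CommutatorBalls
end NilWalk

/-! ### The weight filtration and the index of a generator -/

namespace NilWalk
open FormalComm

section Indices

variable {G : Type*} [Group G] {k d : ℕ} {s : Fin k → G} {w : Fin k → Lex (Fin (d + 1) → ℝ)}

theorem weightIndex_pos (hw : ∀ i, 0 < ofLex (w i) 0) (c : FormalComm k) :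
    1 ≤ c.weightIndex w :=
  (Set.ncard_pos (finite_weights_le w hw _)).2 ⟨_, c, rfl, le_rfl⟩

theorem filtration_antitone : Antitone (filtration s w) := fun _ _ h =>
  Subgroup.closure_mono fun _ ⟨c, hc, he⟩ => ⟨c, h.trans hc, he⟩

/-- The set in the definition of `jStar` is nonempty: finitely many commutators have length at most
L, so their indices are bounded, and longer ones are trivial. -/
theorem filtration_jStar [Group.IsNilpotent G] : filtration s w (jStar s w + 1) = ⊥ := by
  refine Nat.sInf_mem (s := {j | filtration s w (j + 1) = ⊥}) ?_
  obtain ⟨L, hL⟩ := exists_length_eval_eq_one s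
  obtain ⟨B, hB⟩ := ((finite_length_le (k := k) L).image fun c => c.weightIndex w).bddAbove
  refine ⟨B, Subgroup.closure_eq_bot_iff.2 ?_⟩
  rintro _ ⟨c, hc, rfl⟩
  refine hL c ?_
  by_contra h
  have := hB ⟨c, not_lt.1 h, rfl⟩
  simp only at this
  omega

theorem letter_mem_filtration (hw : ∀ i, 0 < ofLex (w i) 0) (i : Fin k) :
    s i ∈ filtration s w 1 :=
  Subgroup.subset_closure ⟨.letter i true, weightIndex_pos hw _, by simp [eval]⟩

theorem exists_word_of_mem_filtration {j : ℕ} {g : G} (hg : g ∈ filtration s w j) :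
    ∃ ω : List (FormalComm k), (∀ c ∈ ω, j ≤ c.weightIndex w) ∧ evalWord s ω = g := by
  induction hg using Subgroup.closure_induction with
  | mem x hx =>
    obtain ⟨c, hc, rfl⟩ := hx
    exact ⟨[c], by simpa using hc, by simp [evalWord]⟩
  | one => exact ⟨[], by simp, by simp [evalWord]⟩
  | mul x y _ _ hx hy =>
    obtain ⟨ω, h, rfl⟩ := hx
    obtain ⟨ω', h', rfl⟩ := hy
    exact ⟨ω ++ ω', fun c hc => (List.mem_append.1 hc).elim (h c) (h' c), evalWord_append s ω ω'⟩
  | inv x _ hx =>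
    obtain ⟨ω, h, rfl⟩ := hx
    refine ⟨_, fun c hc => ?_, evalWord_reverse_inv s ω⟩
    obtain ⟨x, hx, rfl⟩ := List.mem_map.1 hc
    rw [weightIndex_inv]
    exact h x (List.mem_reverse.1 hx)

theorem jIndex_spec [Group.IsNilpotent G] (hw : ∀ i, 0 < ofLex (w i) 0) {i : Fin k}
    (hi : ¬ IsOfFinOrder (s i)) :
    1 ≤ jIndex s w (s i) ∧ jIndex s w (s i) ≤ jStar s w ∧
    (∃ c : FormalComm k, c.weightIndex w = jIndex s w (s i)) ∧
    ∃ u : ℕ, 1 ≤ u ∧ s i ^ u ∈ filtration s w (jIndex s w (s i)) := by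
  set J := {j | ∃ u : ℕ, 1 ≤ u ∧ s i ^ u ∈ filtration s w j} with hJ
  have hle : ∀ j ∈ J, j ≤ jStar s w := by
    rintro j ⟨u, hu, hmem⟩
    by_contra hlt
    have h1 := filtration_antitone (show jStar s w + 1 ≤ j by omega) hmem
    rw [filtration_jStar, Subgroup.mem_bot] at h1
    exact hi (isOfFinOrder_iff_pow_eq_one.2 ⟨u, hu, h1⟩)
  have hbdd : BddAbove J := ⟨_, hle⟩
  have h1J : 1 ∈ J := ⟨1, le_rfl, by simpa using letter_mem_filtration hw i⟩
  have hmem : jIndex s w (s i) ∈ J := Nat.sSup_mem ⟨1, h1J⟩ hbdd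
  refine ⟨le_csSup hbdd h1J, hle _ hmem, ?_, hmem⟩
  -- If no commutator had index exactly j = `jIndex`, the j-th subgroup would lie in the next one,
  -- against maximality. A commutator of index j is needed to relate 𝐅_j to some F_c.
  by_contra hno
  push Not at hno
  have heq : filtration s w (jIndex s w (s i)) ≤ filtration s w (jIndex s w (s i) + 1) := by
    refine Subgroup.closure_mono ?_
    rintro _ ⟨c, hc, rfl⟩
    exact ⟨c, lt_of_le_of_ne hc (hno c).symm, rfl⟩
  obtain ⟨u, hu, hm⟩ := hmem
  have : jIndex s w (s i) + 1 ≤ jIndex s w (s i) := le_csSup hbdd ⟨u, hu, heq hm⟩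
  omega

end Indices

/-! ### Annuli and the size of the radial weight -/

section Comparison

variable {G : Type*} [Group G] {k : ℕ} {s : Fin k → G} {F : Fin k → ℝ → ℝ}

theorem exists_le_of_simeq (hF : ∀ i, IsIncreasing (F i)) (hF1 : IsDoublingSystem F)
    {c : FormalComm k} {f : ℝ → ℝ} (hfc : Simeq f (c.weightFun F)) (t : ℝ) :
    ∃ r, 1 ≤ r ∧ t ≤ f r := by
  obtain ⟨a₁, a₂, a₃, a₄, h₁, h₂, h₃, h₄, hev⟩ := hfc
  obtain ⟨T, hT⟩ := eventually_atTop.1 hev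
  obtain ⟨a, ha, hK⟩ := exists_le_weightFun hF hF1 (a₃ * t)
  set x := max (max T a) (1 / a₄) with hx
  refine ⟨a₄ * x, ?_, ?_⟩
  · have : 1 / a₄ ≤ x := le_max_right _ _
    rwa [div_le_iff₀ h₄, mul_comm] at this
  · have h5 := (hT x (le_trans (le_max_left _ _) (le_max_left _ _))).2
    have h6 := weightFun_mono hF c ha ((le_max_right T a).trans (le_max_left _ (1 / a₄)))
    exact le_of_mul_le_mul_left (((hK c).trans h6).trans h5) h₃

/-- f may lie below t at ρ = f⁻¹(t), but not at 2ρ; `Simeq` bounds f(2ρ) by F_c(2ρ/a₂)/a₁, and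
doubling of F_c returns to ρ. The threshold on t makes ρ large enough for both. -/
theorem exists_le_weightFun_genInv (hF : ∀ i, IsIncreasing (F i)) (hF1 : IsDoublingSystem F)
    {c : FormalComm k} {f : ℝ → ℝ} (hf : IsIncreasing f) (hfc : Simeq f (c.weightFun F)) :
    ∃ K T : ℝ, 0 < K ∧ ∀ t, T ≤ t → t ≤ K * c.weightFun F (genInv f t) := by
  have hne := exists_le_of_simeq hF hF1 hfc
  obtain ⟨a₁, a₂, a₃, a₄, h₁, h₂, h₃, h₄, hev⟩ := hfc
  obtain ⟨T, hT⟩ := eventually_atTop.1 hev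
  obtain ⟨K, hK1, hK⟩ := exists_weightFun_mul_le hF hF1 c (2 / a₂)
  set R := max (max 1 (a₂ / 2)) (T * a₂ / 2) with hR
  have hR1 : 1 ≤ R := (le_max_left _ _).trans (le_max_left _ _)
  refine ⟨K / a₁, f R + 1, by positivity, fun t ht => ?_⟩
  have hρ : R ≤ genInv f t := le_genInv hf.1 (hne t) hR1 (by linarith)
  set ρ := genInv f t
  have hρ1 : 1 ≤ ρ := hR1.trans hρ
  have h5 : t ≤ f (2 * ρ) := le_of_genInv_lt hf.1 (hne t) (by linarith)
  have h6 : 1 ≤ 2 / a₂ * ρ := by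
    have : a₂ / 2 ≤ ρ := ((le_max_right _ _).trans (le_max_left _ _)).trans hρ
    rw [div_mul_eq_mul_div, le_div_iff₀ h₂]
    linarith
  have h7 : T ≤ 2 / a₂ * ρ := by
    have : T * a₂ / 2 ≤ ρ := (le_max_right _ _).trans hρ
    rw [div_mul_eq_mul_div, le_div_iff₀ h₂]
    linarith
  have h8 := (hT _ h7).1
  rw [show a₂ * (2 / a₂ * ρ) = 2 * ρ by field_simp] at h8
  have h9 := hK ρ hρ1 h6
  rw [div_mul_eq_mul_div, le_div_iff₀ h₁]
  nlinarith

/-- No doubling is assumed for f; it is borrowed from F_c. With ρ = f⁻¹(t), one has t' ≤ f(2bρ),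
while f(ρ/2) < t; `Simeq` passes from each value of f to F_c, where doubling compares the two
arguments. -/
theorem exists_le_mul_of_genInv_le (hF : ∀ i, IsIncreasing (F i)) (hF1 : IsDoublingSystem F)
    {c : FormalComm k} {f : ℝ → ℝ} (hf : IsIncreasing f) (hfc : Simeq f (c.weightFun F))
    {b : ℝ} (hb : 1 ≤ b) :
    ∃ K T : ℝ, 1 ≤ K ∧ ∀ t, T ≤ t → ∀ t', genInv f t' ≤ b * genInv f t → t' ≤ K * t := by
  have hne := exists_le_of_simeq hF hF1 hfc
  obtain ⟨a₁, a₂, a₃, a₄, h₁, h₂, h₃, h₄, hev⟩ := hfc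
  obtain ⟨T, hT⟩ := eventually_atTop.1 hev
  obtain ⟨K, hK1, hK⟩ := exists_weightFun_mul_le hF hF1 c (4 * b * a₄ / a₂)
  set R := 3 + a₂ + 2 * a₄ + |T| * a₂ + 2 * a₄ * |T| with hR
  have hT0 := abs_nonneg T
  have hTle := le_abs_self T
  have hT2 : 0 ≤ |T| * a₂ := by positivity
  have hT4 : 0 ≤ 2 * a₄ * |T| := by positivity
  have hR1 : 1 ≤ R := by linarith
  refine ⟨max 1 (K * a₃ / a₁), f R + 1, le_max_left _ _, fun t ht t' htt => ?_⟩
  have ht0 : 0 ≤ t := by linarith [hf.2 R hR1]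
  have hρ : R ≤ genInv f t := le_genInv hf.1 (hne t) hR1 (by linarith)
  set ρ := genInv f t with hρdef
  have hρ1 : 1 ≤ ρ := hR1.trans hρ
  have hbρ : ρ ≤ b * ρ := le_mul_of_one_le_left (by linarith) hb
  have h5 : t' ≤ f (2 * b * ρ) := le_of_genInv_lt hf.1 (hne t') (by nlinarith)
  have h7 : T ≤ 2 * b * ρ / a₂ := by
    rw [le_div_iff₀ h₂]
    nlinarith
  have h8 := (hT _ h7).1
  rw [show a₂ * (2 * b * ρ / a₂) = 2 * b * ρ by field_simp] at h8
  have h9 : 1 ≤ ρ / (2 * a₄) := by rw [le_div_iff₀ (by positivity)]; linarith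
  have h10 : 4 * b * a₄ / a₂ * (ρ / (2 * a₄)) = 2 * b * ρ / a₂ := by field_simp; norm_num
  have h11 : 1 ≤ 2 * b * ρ / a₂ := by
    rw [le_div_iff₀ h₂]
    nlinarith
  have h12 := hK _ h9 (by rw [h10]; exact h11)
  rw [h10] at h12
  have h13 : T ≤ ρ / (2 * a₄) := by
    rw [le_div_iff₀ (by positivity)]
    nlinarith
  have h14 := (hT _ h13).2
  rw [show a₄ * (ρ / (2 * a₄)) = ρ / 2 by field_simp] at h14
  have h15 : f (ρ / 2) < t := lt_of_lt_genInv (by linarith) (by linarith : ρ / 2 < ρ)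
  have h16 : t' ≤ K * a₃ / a₁ * t := by
    rw [div_mul_eq_mul_div, le_div_iff₀ h₁]
    calc t' * a₁ ≤ a₁ * f (2 * b * ρ) := by nlinarith
      _ ≤ K * c.weightFun F (ρ / (2 * a₄)) := h8.trans h12
      _ ≤ K * (a₃ * f (ρ / 2)) := mul_le_mul_of_nonneg_left h14 (by linarith)
      _ ≤ K * (a₃ * t) := by gcongr
      _ = K * a₃ * t := by ring
  exact h16.trans (mul_le_mul_of_nonneg_right (le_max_right _ _) ht0)

/-- z is the first s_i^(2^j) outside a ball a little larger than B(aρ). It exists since s_i has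
infinite order and balls are finite, and being first it is not far outside, as the square of an
element of that ball. If vzy were in B(ρ), then z = v⁻¹(vzy)y⁻¹ would be in the smaller ball. -/
theorem exists_pow_mem_annulus [Group.IsNilpotent G] (hF : ∀ i, IsIncreasing (F i))
    (hF1 : IsDoublingSystem F) {i : Fin k} (hi : ¬ IsOfFinOrder (s i)) {a : ℝ} (ha : 1 ≤ a) :
    ∃ b, 1 ≤ b ∧ ∀ ρ, 1 ≤ ρ → ∃ z : G, ∀ y ∈ comBall s F ρ, ∀ v ∈ comBall s F (a * ρ),
      v * (z * y) ∈ comBall s F (b * ρ) \ comBall s F ρ := by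
  obtain ⟨e, he, hmul⟩ := exists_mul_mem_comBall (s := s) hF hF1
  refine ⟨e * (e * (e * (e * (e * a)))), ?_, fun ρ hρ => ?_⟩
  · have := one_le_mul_of_one_le_of_one_le he ha
    iterate 4 refine one_le_mul_of_one_le_of_one_le he ?_
    exact this
  have one_e {x : ℝ} (hx : 1 ≤ x) : 1 ≤ e * x := one_le_mul_of_one_le_of_one_le he hx
  have le_e {x : ℝ} (hx : 1 ≤ x) : x ≤ e * x := le_mul_of_one_le_left (by linarith) he
  have haρ : 1 ≤ a * ρ := one_le_mul_of_one_le_of_one_le ha hρ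
  have hρa : ρ ≤ a * ρ := le_mul_of_one_le_left (by linarith) ha
  set r := a * ρ with hr
  obtain ⟨z, hz, hz'⟩ : ∃ z : G, z ∈ comBall s F (e * (e * (e * r))) ∧
      z ∉ comBall s F (e * (e * r)) := by
    classical
    have hex : ∃ j : ℕ, s i ^ 2 ^ j ∉ comBall s F (e * (e * r)) := by
      by_contra hall
      push Not at hall
      have hinj : Function.Injective fun j : ℕ => s i ^ 2 ^ j :=
        (injective_pow_iff_not_isOfFinOrder.2 hi).comp (Nat.pow_right_injective le_rfl)
      exact Set.infinite_of_injective_forall_mem hinj hall (finite_comBall _)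
    have hmin := Nat.find_spec hex
    set j := Nat.find hex with hj
    refine ⟨s i ^ 2 ^ j, ?_, hmin⟩
    cases hj' : j with
    | zero => simpa using letter_mem_comBall hF i (one_e (one_e (one_e haρ)))
    | succ n =>
      have hn : s i ^ 2 ^ n ∈ comBall s F (e * (e * r)) := by
        by_contra h
        have := Nat.find_min' hex h
        omega
      rw [pow_succ, mul_two, pow_add]
      exact hmul _ (one_e (one_e haρ)) _ hn _ hn
  refine ⟨z, fun y hy v hv => ⟨?_, fun hmem => hz' ?_⟩⟩
  · have hy' : y ∈ comBall s F (e * (e * (e * r))) :=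
      comBall_mono hF hρ (hρa.trans ((le_e haρ).trans ((le_e (one_e haρ)).trans
        (le_e (one_e (one_e haρ)))))) hy
    have hv' : v ∈ comBall s F (e * (e * (e * (e * r)))) :=
      comBall_mono hF haρ ((le_e haρ).trans ((le_e (one_e haρ)).trans
        ((le_e (one_e (one_e haρ))).trans (le_e (one_e (one_e (one_e haρ))))))) hv
    have := hmul _ (one_e (one_e (one_e (one_e haρ)))) _ hv' _
      (hmul _ (one_e (one_e (one_e haρ))) _ hz _ hy')
    convert this using 2
    rw [hr]; ring
  · have h1 := hmul _ haρ _ (inv_mem_comBall hv) _ (comBall_mono hF hρ hρa hmem)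
    have h2 := hmul _ (one_e haρ) _ h1 _
      (comBall_mono hF hρ (hρa.trans (le_e haρ)) (inv_mem_comBall hy))
    simpa [mul_assoc] using h2

/-- A chain of steps of ratio at most 3/2 joins t to t'; 3/2 stays inside the open interval of
ratios allowed by the hypothesis. -/
theorem exists_le_mul_of_ratio_le {φ : ℝ → ℝ} (hφpos : ∀ t, 0 ≤ t → 0 < φ t)
    (hφdoub : ∃ C : ℝ, ∀ l ∈ Set.Ioo (1 / 2 : ℝ) 2, ∀ t, 0 < t → φ t ≤ C * φ (l * t)) (K : ℝ) :
    ∃ K', 0 < K' ∧ ∀ t t', 0 < t → 0 < t' → t ≤ K * t' → t' ≤ K * t → φ t ≤ K' * φ t' := by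
  obtain ⟨C, hC⟩ := hφdoub
  set C' := max C 1 with hC'
  have hC1 : 1 ≤ C' := le_max_right _ _
  have step {t t' : ℝ} (ht : 0 < t) (h1 : t' < 2 * t) (h2 : t < 2 * t') : φ t ≤ C' * φ t' := by
    have h3 := hC (t' / t) ⟨by rw [lt_div_iff₀ ht]; linarith, by rw [div_lt_iff₀ ht]; linarith⟩ t ht
    rw [div_mul_cancel₀ _ ht.ne'] at h3
    exact h3.trans (mul_le_mul_of_nonneg_right (le_max_left _ _) (hφpos _ (by linarith)).le)
  have key (n : ℕ) : ∀ t t', 0 < t → 0 < t' → t ≤ (3 / 2) ^ n * t' → t' ≤ (3 / 2) ^ n * t →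
      φ t ≤ C' ^ n * φ t' := by
    induction n with
    | zero =>
      intro t t' _ _ h1 h2
      simp only [pow_zero, one_mul] at h1 h2 ⊢
      rw [le_antisymm h1 h2]
    | succ n ih =>
      intro t t' ht ht' h1 h2
      have hpow : (1 : ℝ) ≤ (3 / 2) ^ n := one_le_pow₀ (by norm_num)
      rw [pow_succ] at h1 h2
      obtain ⟨x, hx0, hx1, hx2, hx3, hx4⟩ : ∃ x, 0 < x ∧ x < 2 * t ∧ t < 2 * x ∧
          x ≤ (3 / 2) ^ n * t' ∧ t' ≤ (3 / 2) ^ n * x := by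
        rcases le_total t' t with h | h
        · refine ⟨max (t * (2 / 3)) t', lt_max_of_lt_right ht', max_lt (by linarith) (by linarith),
            ?_, max_le (by nlinarith) (by nlinarith), ?_⟩
          · have := le_max_left (t * (2 / 3)) t'
            linarith
          · have := le_max_right (t * (2 / 3)) t'
            nlinarith
        · refine ⟨min (t * (3 / 2)) t', lt_min (by linarith) ht',
            (min_le_left _ _).trans_lt (by linarith), ?_, ?_, ?_⟩
          · rcases min_choice (t * (3 / 2)) t' with h' | h' <;> rw [h'] <;> linarith
          · have := min_le_right (t * (3 / 2)) t'
            nlinarith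
          · rcases min_choice (t * (3 / 2)) t' with h' | h' <;> rw [h'] <;> nlinarith
      have h3 := step ht hx1 hx2
      have h4 := ih x t' hx0 ht' hx3 hx4
      calc φ t ≤ C' * φ x := h3
        _ ≤ C' * (C' ^ n * φ t') := mul_le_mul_of_nonneg_left h4 (by linarith)
        _ = _ := by ring
  obtain ⟨n, hn⟩ := pow_unbounded_of_one_lt K (by norm_num : (1 : ℝ) < 3 / 2)
  refine ⟨C' ^ n, by positivity, fun t t' ht ht' h1 h2 => key n t t' ht ht' ?_ ?_⟩
  · exact h1.trans (mul_le_mul_of_nonneg_right hn.le ht'.le)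
  · exact h2.trans (mul_le_mul_of_nonneg_right hn.le ht.le)

variable {φ : ℝ → ℝ} {c₀ c₁ : FormalComm k}

theorem radialWeight_pos [Group.IsNilpotent G] (hs : Subgroup.closure (Set.range s) = ⊤)
    (hF : ∀ i, IsIncreasing (F i)) (hF1 : IsDoublingSystem F) (hφpos : ∀ t, 0 ≤ t → 0 < φ t)
    (c₀ : FormalComm k) (g : G) : 0 < radialWeight φ (comNorm s F c₀) g :=
  one_div_pos.2 (mul_pos (hφpos _ (comNorm_nonneg c₀ g)) (volumeFun_comNorm_pos hs hF hF1 c₀ g))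

/-- On the annulus the norm is comparable to F_{c₀}(ρ), hence to F_{c₁}(ρ), so φ takes comparable
values; the norm ball of that radius lies in a fixed dilate of B(ρ), so its volume is O(|B(ρ)|). -/
theorem exists_le_radialWeight [Group.IsNilpotent G] (hs : Subgroup.closure (Set.range s) = ⊤)
    (hF : ∀ i, IsIncreasing (F i)) (hF1 : IsDoublingSystem F)
    (h01 : ∃ C : ℝ, 1 ≤ C ∧ ∀ r, 1 ≤ r → c₀.weightFun F r ≤ C * c₁.weightFun F r)
    (h10 : ∃ C : ℝ, 1 ≤ C ∧ ∀ r, 1 ≤ r → c₁.weightFun F r ≤ C * c₀.weightFun F r)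
    (hφpos : ∀ t, 0 ≤ t → 0 < φ t)
    (hφdoub : ∃ C : ℝ, ∀ l ∈ Set.Ioo (1 / 2 : ℝ) 2, ∀ t, 0 < t → φ t ≤ C * φ (l * t))
    {b : ℝ} (hb : 1 ≤ b) :
    ∃ K, 0 < K ∧ ∀ ρ, 1 ≤ ρ → ∀ y ∈ comBall s F (b * ρ) \ comBall s F ρ,
      1 / φ (c₁.weightFun F ρ) ≤
        K * (comBall s F ρ).ncard * radialWeight φ (comNorm s F c₀) y := by
  obtain ⟨C, hC1, hC⟩ := h01
  obtain ⟨C', hC1', hC'⟩ := h10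
  obtain ⟨a, ha, hnorm⟩ := exists_comNorm_le (s := s) hF hF1 c₀
  obtain ⟨a', ha', h2⟩ := exists_mul_weightFun_le hF hF1 2
  obtain ⟨K₀, hK₀, hup⟩ := exists_weightFun_mul_le hF hF1 c₀ (a * b)
  obtain ⟨M, hM⟩ := exists_ncard_comBall_le (s := s) hF hF1 (a' * (a * b))
    (one_le_mul_of_one_le_of_one_le ha' (one_le_mul_of_one_le_of_one_le ha hb))
  obtain ⟨K', hK', hφ⟩ := exists_le_mul_of_ratio_le hφpos hφdoub (K₀ * C + C')
  refine ⟨K' * (M + 1), by positivity, fun ρ hρ y hy => ?_⟩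
  have hbρ : 1 ≤ b * ρ := one_le_mul_of_one_le_of_one_le hb hρ
  have habρ : 1 ≤ a * b * ρ := by
    rw [mul_assoc]; exact one_le_mul_of_one_le_of_one_le ha hbρ
  set N := comNorm s F c₀ y with hN
  have hN1 : N ≤ c₀.weightFun F (a * b * ρ) := by
    have := (hnorm (b * ρ) hbρ y hy.1).2
    rwa [← mul_assoc] at this
  have hN2 : c₀.weightFun F ρ ≤ N :=
    not_lt.1 fun h => hy.2 (mem_comBall_of_comNorm_lt hs hF hF1 c₀ hρ h)
  have hf0 := one_le_weightFun hF c₀ hρ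
  have hf1 := one_le_weightFun hF c₁ hρ
  have hVle : volumeFun (comNorm s F c₀) N ≤ M * (comBall s F ρ).ncard := by
    have hsub : {g : G | comNorm s F c₀ g ≤ N} ⊆ comBall s F (a' * (a * b) * ρ) := by
      intro g hg
      have h3 : 1 ≤ a' * (a * b) * ρ := by
        rw [mul_assoc]; exact one_le_mul_of_one_le_of_one_le ha' habρ
      refine mem_comBall_of_comNorm_lt hs hF hF1 c₀ h3 (lt_of_le_of_lt (le_trans hg hN1) ?_)
      have h4 := h2 c₀ _ habρ
      have h5 := one_le_weightFun hF c₀ habρ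
      rw [mul_assoc a']
      linarith
    have h3 := (Set.ncard_le_ncard hsub (finite_comBall _)).trans (hM ρ hρ)
    unfold volumeFun
    exact_mod_cast h3
  have hVpos : 0 < volumeFun (comNorm s F c₀) N := volumeFun_comNorm_pos hs hF hF1 c₀ y
  have hφle : φ N ≤ K' * φ (c₁.weightFun F ρ) := by
    have h3 := hup ρ hρ habρ
    refine hφ _ _ (by linarith) (by linarith) ?_ ?_
    · have h4 := mul_le_mul_of_nonneg_left (hC ρ hρ) (by linarith : 0 ≤ K₀)
      nlinarith
    · have h4 := hC' ρ hρ
      have h5 : C' * c₀.weightFun F ρ ≤ C' * N := mul_le_mul_of_nonneg_left hN2 (by linarith)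
      have h6 : 0 ≤ K₀ * C * N := by
        have : 0 ≤ N := by linarith
        positivity
      linarith
  have hφN : 0 < φ N := hφpos _ (by linarith)
  have hφ1 : 0 < φ (c₁.weightFun F ρ) := hφpos _ (by linarith)
  unfold radialWeight
  rw [← hN, mul_one_div, div_le_div_iff₀ hφ1 (by positivity), one_mul]
  have hn0 : (0 : ℝ) ≤ (comBall s F ρ).ncard := Nat.cast_nonneg _
  calc φ N * volumeFun (comNorm s F c₀) N
      ≤ (K' * φ (c₁.weightFun F ρ)) * (M * (comBall s F ρ).ncard) :=
        mul_le_mul hφle hVle hVpos.le (by positivity)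
    _ ≤ (K' * φ (c₁.weightFun F ρ)) * ((M + 1) * (comBall s F ρ).ncard) := by gcongr; linarith
    _ = _ := by ring

end Comparison
end NilWalk

/-! ### Convolution operators and the trace on ℓ²(G) -/

namespace NilWalk

section ConvolutionOperators

open scoped InnerProductSpace

section SquareSummable

variable {G : Type*}

local notation "ℓ₂" => lp (fun _ : G => ℝ) 2

theorem memℓp_comp (σ : G ≃ G) (f : ℓ₂) : Memℓp (fun x => f (σ x)) 2 := by
  have h := (memℓp_gen_iff (by norm_num)).1 (lp.memℓp f)
  exact (memℓp_gen_iff (by norm_num)).2 (h.comp_injective σ.injective)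

theorem l2_norm_sq (f : ℓ₂) : ‖f‖ ^ 2 = ∑' x, f x ^ 2 := by
  rw [← real_inner_self_eq_norm_sq, lp.inner_eq_tsum]
  refine tsum_congr fun x => ?_
  simp [pow_two]

theorem l2_summable_sq (f : ℓ₂) : Summable fun x => f x ^ 2 := by
  refine (lp.summable_inner f f).congr fun x => ?_
  simp [pow_two]

/-- Composition with a permutation, as an isometry of `ℓ²(G)`. -/
noncomputable def l2Comp (σ : G ≃ G) : ℓ₂ →ₗᵢ[ℝ] ℓ₂ where
  toFun f := ⟨fun x => f (σ x), memℓp_comp σ f⟩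
  map_add' _ _ := rfl
  map_smul' _ _ := rfl
  norm_map' f := by
    rw [← sq_eq_sq₀ (norm_nonneg _) (norm_nonneg _), l2_norm_sq, l2_norm_sq]
    exact σ.tsum_eq fun x => f x ^ 2

theorem l2Comp_apply (σ : G ≃ G) (f : ℓ₂) (x : G) : l2Comp σ f x = f (σ x) := rfl

theorem inner_l2Comp (σ : G ≃ G) (f g : ℓ₂) :
    ⟪l2Comp σ f, g⟫_ℝ = ⟪f, l2Comp σ.symm g⟫_ℝ := by
  have h : g = l2Comp σ (l2Comp σ.symm g) := by ext x; simp [l2Comp_apply]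
  conv_lhs => rw [h]
  exact (l2Comp σ).inner_map_map _ _

end SquareSummable

variable {G : Type*} [Group G]

/-- Symmetric probability measures on a group. -/
structure IsSymmLaw (μ : G → ℝ) : Prop where
  nonneg : ∀ x, 0 ≤ μ x
  symm : ∀ x, μ x⁻¹ = μ x
  hasSum : HasSum μ 1

local notation "ℓ₂" => lp (fun _ : G => ℝ) 2

/-- Right convolution by a symmetric measure, on `ℓ²(G)`. -/
noncomputable def convOp (μ : G → ℝ) : ℓ₂ →L[ℝ] ℓ₂ :=
  ∑' y, μ y • (l2Comp (Equiv.mulRight y)).toContinuousLinearMap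

open Classical in
/-- The unit mass at the identity. -/
noncomputable def delta (G : Type*) [Group G] : lp (fun _ : G => ℝ) 2 := lp.single 2 1 1

theorem inner_delta (f : ℓ₂) : ⟪f, delta G⟫_ℝ = f 1 := by
  classical
  rw [delta, lp.inner_single_right]
  simp

open Classical in
theorem delta_apply (x : G) : delta G x = if x = 1 then 1 else 0 := by
  rw [delta, lp.single_apply]
  by_cases h : x = 1
  · subst h; simp
  · simp [h]

variable {μ ν : G → ℝ}

theorem IsSymmLaw.summable_smul (hμ : IsSymmLaw μ) :
    Summable fun y => μ y • (l2Comp (Equiv.mulRight y)).toContinuousLinearMap := by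
  refine Summable.of_norm_bounded hμ.hasSum.summable fun y => ?_
  rw [norm_smul, Real.norm_of_nonneg (hμ.nonneg y)]
  exact mul_le_of_le_one_right (hμ.nonneg y) (LinearIsometry.norm_toContinuousLinearMap_le _)

theorem IsSymmLaw.hasSum_convOp (hμ : IsSymmLaw μ) (f : ℓ₂) :
    HasSum (fun y => μ y • l2Comp (Equiv.mulRight y) f) (convOp μ f) := by
  have h := hμ.summable_smul.hasSum.mapL (ContinuousLinearMap.apply ℝ ℓ₂ f)
  simp only [ContinuousLinearMap.apply_apply, smul_apply,
    LinearIsometry.coe_toContinuousLinearMap] at h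
  exact h

theorem IsSymmLaw.hasSum_inner (hμ : IsSymmLaw μ) (f g : ℓ₂) :
    HasSum (fun y => μ y * ⟪l2Comp (Equiv.mulRight y) f, g⟫_ℝ) ⟪convOp μ f, g⟫_ℝ := by
  have := (innerSL ℝ g).hasSum (hμ.hasSum_convOp f)
  simpa [Function.comp_def, inner_smul_right, real_inner_comm] using this

theorem IsSymmLaw.norm_convOp_le (hμ : IsSymmLaw μ) : ‖convOp μ‖ ≤ 1 := by
  refine tsum_of_norm_bounded hμ.hasSum fun y => ?_
  rw [norm_smul, Real.norm_of_nonneg (hμ.nonneg y)]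
  exact mul_le_of_le_one_right (hμ.nonneg y) (LinearIsometry.norm_toContinuousLinearMap_le _)

theorem IsSymmLaw.convOp_apply (hμ : IsSymmLaw μ) (f : ℓ₂) (x : G) :
    convOp μ f x = ∑' y, μ y * f (x * y) :=
  (((lp.evalCLM ℝ (fun _ : G => ℝ) 2 x).hasSum (hμ.hasSum_convOp f)).tsum_eq).symm

theorem IsSymmLaw.convOp_symm (hμ : IsSymmLaw μ) (f g : ℓ₂) :
    ⟪convOp μ f, g⟫_ℝ = ⟪f, convOp μ g⟫_ℝ := by
  rw [← (hμ.hasSum_inner f g).tsum_eq, real_inner_comm, ← (hμ.hasSum_inner g f).tsum_eq,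
    ← (Equiv.inv G).tsum_eq]
  refine tsum_congr fun y => ?_
  rw [Equiv.inv_apply, hμ.symm, inner_l2Comp, real_inner_comm]
  congr 4
  ext x
  simp

/-- Commutation with left translations. -/
def IsLeftInvariant (T : ℓ₂ →L[ℝ] ℓ₂) : Prop :=
  ∀ (g : G) (f : ℓ₂), T (l2Comp (Equiv.mulLeft g) f) = l2Comp (Equiv.mulLeft g) (T f)

/-- Self-adjoint operators commuting with left translations. -/
structure IsInvSymm (T : ℓ₂ →L[ℝ] ℓ₂) : Prop where
  symm : ∀ f g : ℓ₂, ⟪T f, g⟫_ℝ = ⟪f, T g⟫_ℝ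
  comm : IsLeftInvariant T

theorem IsSymmLaw.isInvSymm (hμ : IsSymmLaw μ) : IsInvSymm (convOp μ) where
  symm := hμ.convOp_symm
  comm g f := by
    ext x
    rw [hμ.convOp_apply, l2Comp_apply, hμ.convOp_apply]
    simp [l2Comp_apply, mul_assoc]

theorem IsLeftInvariant.mul {A B : ℓ₂ →L[ℝ] ℓ₂} (hA : IsLeftInvariant A)
    (hB : IsLeftInvariant B) : IsLeftInvariant (A * B) := fun g f => by
  simp [hA g, hB g]

theorem IsInvSymm.one : IsInvSymm (1 : ℓ₂ →L[ℝ] ℓ₂) := ⟨fun _ _ => rfl, fun _ _ => rfl⟩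

theorem IsInvSymm.add {A B : ℓ₂ →L[ℝ] ℓ₂} (hA : IsInvSymm A) (hB : IsInvSymm B) :
    IsInvSymm (A + B) :=
  ⟨fun f g => by simp [inner_add_left, inner_add_right, hA.symm, hB.symm],
    fun g f => by simp [hA.comm g, hB.comm g]⟩

theorem IsInvSymm.smul {A : ℓ₂ →L[ℝ] ℓ₂} (hA : IsInvSymm A) (a : ℝ) : IsInvSymm (a • A) :=
  ⟨fun f g => by simp [inner_smul_left, inner_smul_right, hA.symm],
    fun g f => by simp [hA.comm g]⟩

theorem IsInvSymm.pow {A : ℓ₂ →L[ℝ] ℓ₂} (hA : IsInvSymm A) (n : ℕ) : IsInvSymm (A ^ n) := by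
  induction n with
  | zero => exact IsInvSymm.one
  | succ n ih =>
    refine ⟨fun f g => ?_, ?_⟩
    · rw [pow_succ, mul_apply_eq_comp, ih.symm, hA.symm, ← mul_apply_eq_comp,
        ← pow_succ', pow_succ]
    · rw [pow_succ]; exact ih.comm.mul hA.comm

/-- The trace property of the group von Neumann algebra. -/
theorem IsInvSymm.inner_mul_comm {A B : ℓ₂ →L[ℝ] ℓ₂} (hA : IsInvSymm A)
    (hB : IsLeftInvariant B) :
    ⟪(A * B) (delta G), delta G⟫_ℝ = ⟪(B * A) (delta G), delta G⟫_ℝ := by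
  classical
  have hsingle (x : G) : (lp.single 2 x 1 : ℓ₂) = l2Comp (Equiv.mulLeft x⁻¹) (delta G) := by
    ext y
    rw [l2Comp_apply, delta_apply, lp.single_apply]
    by_cases h : y = x
    · subst h; simp
    · have : ¬ x⁻¹ * y = 1 := fun h' => h (by rwa [inv_mul_eq_one, eq_comm] at h')
      simp [h, this]
  -- Self-adjointness and left invariance make Aδ invariant under inversion. The two traces are ∑
  -- Aδ(x) Bδ(x) and ∑ Aδ(x) Bδ(x⁻¹), so they agree.
  have hsymm (x : G) : A (delta G) x⁻¹ = A (delta G) x := by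
    have h1 : A (delta G) x = ⟪A (delta G), (lp.single 2 x 1 : ℓ₂)⟫_ℝ := by
      rw [lp.inner_single_right]; simp
    rw [h1, hA.symm, hsingle, hA.comm, real_inner_comm, inner_delta, l2Comp_apply]
    simp
  have h1 : ⟪(A * B) (delta G), delta G⟫_ℝ = ∑' x, A (delta G) x * B (delta G) x := by
    rw [mul_apply_eq_comp, hA.symm, real_inner_comm, lp.inner_eq_tsum]
    refine tsum_congr fun x => ?_
    simp [mul_comm]
  have h2 : HasSum (fun x => A (delta G) x * B (delta G) x⁻¹) ((B * A) (delta G) 1) := by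
    have h3 := lp.hasSum_single (by norm_num) (A (delta G))
    have h4 := ((lp.evalCLM ℝ (fun _ : G => ℝ) 2 1).comp B).hasSum h3
    refine h4.congr_fun fun x => ?_
    have h5 : (lp.single 2 x (A (delta G) x) : ℓ₂) =
        (A (delta G) x) • (lp.single 2 x 1 : ℓ₂) := by
      rw [← lp.single_smul]; simp
    rw [h5, map_smul, hsingle]
    change _ = A (delta G) x * B (l2Comp (Equiv.mulLeft x⁻¹) (delta G)) 1
    rw [hB, l2Comp_apply]
    simp
  rw [h1, inner_delta, ← h2.tsum_eq, ← (Equiv.inv G).tsum_eq]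
  refine tsum_congr fun x => ?_
  rw [Equiv.inv_apply, hsymm]

/-- Along the segment Z_t = Y + t(X - Y) the trace property turns the derivative of tr Z_t^{2k+1}
into 2k+1 copies of tr(Z_t^k (X - Y) Z_t^k) ≥ 0. An odd exponent leaves equal powers on both sides,
so neither X nor Y has to be positive. -/
theorem IsInvSymm.inner_odd_pow_le {X Y : ℓ₂ →L[ℝ] ℓ₂} (hX : IsInvSymm X) (hY : IsInvSymm Y)
    (hXY : ∀ f : ℓ₂, ⟪Y f, f⟫_ℝ ≤ ⟪X f, f⟫_ℝ) (k : ℕ) :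
    ⟪(Y ^ (2 * k + 1)) (delta G), delta G⟫_ℝ ≤ ⟪(X ^ (2 * k + 1)) (delta G), delta G⟫_ℝ := by
  set D := X - Y with hD
  have hDs : IsInvSymm D := by
    have := hX.add (hY.smul (-1))
    rwa [neg_one_smul, ← sub_eq_add_neg] at this
  set Z : ℝ → (ℓ₂ →L[ℝ] ℓ₂) := fun t => Y + t • D with hZ
  have hZs (t : ℝ) : IsInvSymm (Z t) := hY.add (hDs.smul t)
  have hderivZ (t : ℝ) : HasDerivAt Z D t := by
    have := ((hasDerivAt_id t).smul_const D).const_add Y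
    rw [one_smul] at this
    exact this
  set τ : (ℓ₂ →L[ℝ] ℓ₂) →L[ℝ] ℝ :=
    (innerSL ℝ (delta G)).comp (ContinuousLinearMap.apply ℝ ℓ₂ (delta G)) with hτ
  have hτ' (T : ℓ₂ →L[ℝ] ℓ₂) : τ T = ⟪T (delta G), delta G⟫_ℝ := by
    simp [hτ, real_inner_comm]
  have hder (t : ℝ) : HasDerivAt (fun t => τ (Z t ^ (2 * k + 1)))
      (τ (∑ i ∈ Finset.range (2 * k + 1), Z t ^ ((2 * k + 1).pred - i) * D * Z t ^ i)) t :=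
    τ.hasFDerivAt.comp_hasDerivAt t ((hderivZ t).fun_pow' (2 * k + 1))
  have hmono : Monotone fun t => τ (Z t ^ (2 * k + 1)) := by
    refine monotone_of_hasDerivAt_nonneg hder fun t => ?_
    rw [map_sum]
    refine Finset.sum_nonneg fun i hi => ?_
    have hi' : i < 2 * k + 1 := Finset.mem_range.1 hi
    have he : i + ((2 * k + 1).pred - i) = k + k := by
      simp only [Nat.pred_eq_sub_one]
      omega
    have h1 : τ (Z t ^ ((2 * k + 1).pred - i) * D * Z t ^ i) = τ (Z t ^ k * (D * Z t ^ k)) := by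
      rw [hτ', hτ', mul_assoc,
        ((hZs t).pow _).inner_mul_comm (hDs.comm.mul ((hZs t).pow i).comm),
        ((hZs t).pow _).inner_mul_comm (hDs.comm.mul ((hZs t).pow k).comm), mul_assoc, mul_assoc,
        ← pow_add, ← pow_add, he]
    rw [h1, hτ', mul_apply_eq_comp, ((hZs t).pow k).symm, mul_apply_eq_comp]
    have := hXY ((Z t ^ k) (delta G))
    rw [hD, sub_apply, inner_sub_left]
    linarith
  have h := hmono zero_le_one
  simpa [hZ, hτ', hD] using h

/-! ### Return probabilities -/

theorem IsSymmLaw.convOp_pow_delta (hμ : IsSymmLaw μ) (n : ℕ) (x : G) :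
    (convOp μ ^ n) (delta G) x = convPow μ n x := by
  induction n generalizing x with
  | zero => simp [convPow, delta_apply]
  | succ n ih =>
    rw [pow_succ', mul_apply_eq_comp, hμ.convOp_apply, convPow,
      ← (Equiv.mulLeft x).tsum_eq fun z => convPow μ n z * μ (z⁻¹ * x)]
    refine tsum_congr fun y => ?_
    rw [ih, Equiv.coe_mulLeft, mul_comm, ← hμ.symm y]
    congr 2
    simp

theorem IsSymmLaw.inner_convOp_pow (hμ : IsSymmLaw μ) (n : ℕ) :
    ⟪(convOp μ ^ n) (delta G), delta G⟫_ℝ = convPow μ n 1 := by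
  rw [inner_delta, hμ.convOp_pow_delta]

theorem IsSymmLaw.convPow_nonneg (hμ : IsSymmLaw μ) (n : ℕ) (x : G) : 0 ≤ convPow μ n x := by
  induction n generalizing x with
  | zero => unfold convPow; split_ifs <;> norm_num
  | succ n ih => exact tsum_nonneg fun y => mul_nonneg (ih y) (hμ.nonneg _)

theorem IsSymmLaw.convPow_add_one (hμ : IsSymmLaw μ) (m n : ℕ) :
    convPow μ (m + n) 1 = ⟪(convOp μ ^ m) (delta G), (convOp μ ^ n) (delta G)⟫_ℝ := by
  rw [← (hμ.isInvSymm.pow n).symm, ← mul_apply_eq_comp, ← pow_add, add_comm n m,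
    hμ.inner_convOp_pow]

/-- Only the paths that are at the identity at time m are kept. -/
theorem IsSymmLaw.convPow_mul_le (hμ : IsSymmLaw μ) (m n : ℕ) :
    convPow μ m 1 * convPow μ n 1 ≤ convPow μ (m + n) 1 := by
  rw [hμ.convPow_add_one, lp.inner_eq_tsum]
  have hs := lp.summable_inner (𝕜 := ℝ) ((convOp μ ^ m) (delta G)) ((convOp μ ^ n) (delta G))
  refine le_trans (le_of_eq ?_) (hs.le_tsum 1 fun x _ => ?_)
  · rw [RCLike.inner_apply, conj_trivial, hμ.convOp_pow_delta, hμ.convOp_pow_delta, mul_comm]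
  · simp only [hμ.convOp_pow_delta, RCLike.inner_apply, conj_trivial]
    exact mul_nonneg (hμ.convPow_nonneg _ _) (hμ.convPow_nonneg _ _)

theorem IsSymmLaw.norm_convOp_pow_apply_le (hμ : IsSymmLaw μ) (j : ℕ) (v : ℓ₂) :
    ‖(convOp μ ^ j) v‖ ≤ ‖v‖ := by
  induction j with
  | zero => simp
  | succ j ih =>
    rw [pow_succ', mul_apply_eq_comp]
    exact (((convOp μ).le_opNorm _).trans
      (mul_le_of_le_one_left (norm_nonneg _) hμ.norm_convOp_le)).trans ih

theorem IsSymmLaw.convPow_le_even (hμ : IsSymmLaw μ) {n m : ℕ} (h : 2 * m ≤ n) :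
    convPow μ n 1 ≤ convPow μ (2 * m) 1 := by
  obtain ⟨j, rfl⟩ := Nat.exists_eq_add_of_le h
  have h1 : convPow μ (2 * m + j) 1 = ⟪(convOp μ ^ j) ((convOp μ ^ m) (delta G)),
      (convOp μ ^ m) (delta G)⟫_ℝ := by
    rw [← mul_apply_eq_comp, ← pow_add, ← hμ.convPow_add_one]
    congr 1
    omega
  have h2 : convPow μ (2 * m) 1 = ‖(convOp μ ^ m) (delta G)‖ ^ 2 := by
    rw [two_mul, hμ.convPow_add_one, real_inner_self_eq_norm_sq]
  rw [h1, h2]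
  refine (real_inner_le_norm _ _).trans ?_
  rw [pow_two]
  exact mul_le_mul_of_nonneg_right (hμ.norm_convOp_pow_apply_le j _) (norm_nonneg _)

theorem convPow_zero_one (μ : G → ℝ) : convPow μ 0 1 = 1 := by simp [convPow]

theorem IsSymmLaw.convPow_one_le_one (hμ : IsSymmLaw μ) (n : ℕ) : convPow μ n 1 ≤ 1 := by
  have := hμ.convPow_le_even (m := 0) (n := n) (by omega)
  rwa [mul_zero, convPow_zero_one] at this

theorem IsSymmLaw.convPow_two_pos (hμ : IsSymmLaw μ) : 0 < convPow μ 2 1 := by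
  have h : convPow μ (1 + 1) 1 = ‖(convOp μ ^ 1) (delta G)‖ ^ 2 := by
    rw [hμ.convPow_add_one, real_inner_self_eq_norm_sq]
  rw [show (2 : ℕ) = 1 + 1 from rfl, h]
  refine pow_pos (norm_pos_iff.2 fun h0 => ?_) 2
  have hz : ∀ x, μ x = 0 := by
    intro x
    have h1 := hμ.convOp_pow_delta 1 x
    rw [h0] at h1
    have h2 : convPow μ 1 x = μ x := by
      classical
      simp only [convPow]
      rw [tsum_eq_single 1 (by intro y hy; simp [hy])]
      simp
    rw [← h2, ← h1]
    rfl
  have h1 := hμ.hasSum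
  rw [show μ = fun _ => 0 from funext hz] at h1
  exact one_ne_zero (h1.unique hasSum_zero)

theorem IsSymmLaw.pow_convPow_le (hμ : IsSymmLaw μ) (m n : ℕ) :
    convPow μ (2 * m) 1 ^ n ≤ convPow μ (2 * (m * n)) 1 := by
  induction n with
  | zero => simp [convPow_zero_one]
  | succ n ih =>
    have h1 := hμ.convPow_mul_le (2 * (m * n)) (2 * m)
    have h2 := hμ.convPow_nonneg (2 * m) 1
    rw [pow_succ, show 2 * (m * (n + 1)) = 2 * (m * n) + 2 * m by ring]
    exact (mul_le_mul_of_nonneg_right ih h2).trans h1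

theorem IsSymmLaw.dirichlet_eq (hμ : IsSymmLaw μ) (f : ℓ₂) :
    dirichlet μ f = ENNReal.ofReal (‖f‖ ^ 2 - ⟪convOp μ f, f⟫_ℝ) := by
  unfold dirichlet
  rw [ENNReal.tsum_comm]
  have h1 (y : G) : ∑' x, ENNReal.ofReal (|f (x * y) - f x| ^ 2 * μ y) =
      ENNReal.ofReal (2 * (μ y * ‖f‖ ^ 2 - μ y * ⟪l2Comp (Equiv.mulRight y) f, f⟫_ℝ)) := by
    have h2 : ∀ x, |f (x * y) - f x| ^ 2 * μ y = (l2Comp (Equiv.mulRight y) f - f) x ^ 2 * μ y := by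
      intro x
      rw [sq_abs]
      rfl
    simp only [h2]
    rw [← ENNReal.ofReal_tsum_of_nonneg
      (fun x => mul_nonneg (sq_nonneg _) (hμ.nonneg y)) ((l2_summable_sq _).mul_right _),
      tsum_mul_right, ← l2_norm_sq, norm_sub_sq_real, LinearIsometry.norm_map]
    congr 1
    ring
  have hsum : HasSum (fun y => 2 * (μ y * ‖f‖ ^ 2 - μ y * ⟪l2Comp (Equiv.mulRight y) f, f⟫_ℝ))
      (2 * (1 * ‖f‖ ^ 2 - ⟪convOp μ f, f⟫_ℝ)) :=
    ((hμ.hasSum.mul_right _).sub (hμ.hasSum_inner f f)).mul_left 2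
  have hnn (y : G) :
      0 ≤ 2 * (μ y * ‖f‖ ^ 2 - μ y * ⟪l2Comp (Equiv.mulRight y) f, f⟫_ℝ) := by
    have h3 := real_inner_le_norm (l2Comp (Equiv.mulRight y) f) f
    rw [LinearIsometry.norm_map, ← pow_two] at h3
    nlinarith [hμ.nonneg y]
  simp only [h1]
  rw [← ENNReal.ofReal_tsum_of_nonneg hnn hsum.summable, hsum.tsum_eq,
    show (1 / 2 : ℝ≥0∞) = ENNReal.ofReal (1 / 2) by
      rw [ENNReal.ofReal_div_of_pos two_pos]; simp,
    ← ENNReal.ofReal_mul (by norm_num)]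
  congr 1
  ring

theorem IsSymmLaw.inner_convOp_le (hμ : IsSymmLaw μ) (f : ℓ₂) :
    ⟪convOp μ f, f⟫_ℝ ≤ ‖f‖ ^ 2 := by
  refine (real_inner_le_norm _ _).trans ?_
  rw [pow_two]
  refine mul_le_mul_of_nonneg_right ?_ (norm_nonneg _)
  exact ((convOp μ).le_opNorm _).trans (mul_le_of_le_one_left (norm_nonneg _) hμ.norm_convOp_le)

theorem IsSymmLaw.inner_affine_pow (hμ : IsSymmLaw μ) (a b : ℝ) (n : ℕ) :
    ⟪((a • convOp μ + b • (1 : ℓ₂ →L[ℝ] ℓ₂)) ^ n) (delta G), delta G⟫_ℝ =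
      ∑ m ∈ Finset.range (n + 1), a ^ m * b ^ (n - m) * n.choose m * convPow μ m 1 := by
  have hc : Commute (a • convOp μ) (b • (1 : ℓ₂ →L[ℝ] ℓ₂)) :=
    ((Commute.one_right _).smul_left a).smul_right b
  rw [hc.add_pow, sum_apply, sum_inner]
  refine Finset.sum_congr rfl fun m _ => ?_
  rw [← hμ.inner_convOp_pow]
  have : (a • convOp μ) ^ m * (b • (1 : ℓ₂ →L[ℝ] ℓ₂)) ^ (n - m) * ((n.choose m : ℕ) : ℓ₂ →L[ℝ] ℓ₂) =
      (a ^ m * b ^ (n - m) * n.choose m) • convOp μ ^ m := by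
    rw [smul_pow, smul_pow, one_pow, smul_mul_smul_comm, mul_one, ← nsmul_one, mul_smul_comm,
      mul_one, ← Nat.cast_smul_eq_nsmul ℝ, smul_smul, mul_comm (n.choose m : ℝ)]
  rw [this, smul_apply, real_inner_smul_left]

/-- Only even powers are kept: each return probability is at least the one at time 2k, and even
indices carry half of the binomial mass. -/
theorem IsSymmLaw.le_inner_half_pow (hν : IsSymmLaw ν) (k : ℕ) :
    convPow ν (2 * k) 1 / 2 ≤
      ⟪(((1 / 2 : ℝ) • convOp ν + (1 / 2 : ℝ) • (1 : ℓ₂ →L[ℝ] ℓ₂)) ^ (2 * k + 1)) (delta G),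
        delta G⟫_ℝ := by
  rw [hν.inner_affine_pow]
  set q := convPow ν (2 * k) 1 with hq
  have hsum : ∑ m ∈ Finset.range (k + 1), ((2 * k + 1).choose (2 * m) : ℝ) = 2 ^ (2 * k) := by
    have h1 := Nat.sum_range_choose (2 * k + 1)
    have h2 := Int.alternating_sum_range_choose_of_ne (n := 2 * k + 1) (by omega)
    have h3 (g : ℕ → ℝ) : ∑ m ∈ Finset.range (2 * k + 1 + 1), g m =
        ∑ m ∈ Finset.range (k + 1), (g (2 * m) + g (2 * m + 1)) := by
      clear h1 h2 hq
      induction k with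
      | zero => simp [Finset.sum_range_succ]
      | succ k ih =>
        rw [Finset.sum_range_succ _ (k + 1), ← ih, show 2 * (k + 1) + 1 + 1 = 2 * k + 1 + 1 + 1 + 1
          by ring, Finset.sum_range_succ, Finset.sum_range_succ, add_assoc]
        rfl
    have h1' : ∑ m ∈ Finset.range (2 * k + 1 + 1), ((2 * k + 1).choose m : ℝ) = 2 ^ (2 * k + 1) := by
      exact_mod_cast h1
    have h2' : ∑ m ∈ Finset.range (2 * k + 1 + 1), ((-1) ^ m * (2 * k + 1).choose m : ℝ) = 0 := by
      exact_mod_cast h2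
    rw [h3] at h1' h2'
    have h4 : ∀ m : ℕ, ((-1 : ℝ) ^ (2 * m)) = 1 := fun m => by rw [pow_mul]; simp
    simp only [pow_succ, h4, one_mul, mul_neg, mul_one, neg_mul, Finset.sum_add_distrib] at h1' h2'
    rw [Finset.sum_neg_distrib] at h2'
    linarith
  have hle : ∀ m ∈ Finset.range (k + 1), (1 / 2 : ℝ) ^ (2 * k + 1) * (2 * k + 1).choose (2 * m) * q ≤
      (1 / 2 : ℝ) ^ (2 * m) * (1 / 2) ^ (2 * k + 1 - 2 * m) * (2 * k + 1).choose (2 * m) *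
        convPow ν (2 * m) 1 := by
    intro m hm
    have hm' : m < k + 1 := Finset.mem_range.1 hm
    rw [← pow_add, show 2 * m + (2 * k + 1 - 2 * m) = 2 * k + 1 by omega]
    exact mul_le_mul_of_nonneg_left (hν.convPow_le_even (by omega)) (by positivity)
  have hcalc : ∑ m ∈ Finset.range (k + 1),
      (1 / 2 : ℝ) ^ (2 * k + 1) * (2 * k + 1).choose (2 * m) * q = q / 2 := by
    rw [← Finset.sum_mul, ← Finset.mul_sum, hsum, pow_succ, one_div, inv_pow]
    field_simp
  rw [← hcalc]
  refine (Finset.sum_le_sum hle).trans ?_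
  rw [← Finset.sum_image (f := fun m => (1 / 2 : ℝ) ^ m * (1 / 2) ^ (2 * k + 1 - m) *
    (2 * k + 1).choose m * convPow ν m 1) (s := Finset.range (k + 1)) (g := fun m => 2 * m)
    (by intro a _ b _ h; simpa using h)]
  refine Finset.sum_le_sum_of_subset_of_nonneg ?_ fun m _ _ => ?_
  · intro x hx
    obtain ⟨m, hm, rfl⟩ := Finset.mem_image.1 hx
    have := Finset.mem_range.1 hm
    exact Finset.mem_range.2 (by omega)
  · have := hν.convPow_nonneg m 1
    positivity

/-- Terms with j ≥ 2m are at most the return probability at time 2m. For j < 2m that probability is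
bounded by 1 and l^j ≤ 4^m (l/2)^j, which sums to 4^m (1 - l/2)^n. -/
theorem IsSymmLaw.inner_lazy_pow_le (hμ : IsSymmLaw μ) {l : ℝ} (h0 : 0 ≤ l) (h1 : l ≤ 1)
    (m n : ℕ) :
    ⟪((l • convOp μ + (1 - l) • (1 : ℓ₂ →L[ℝ] ℓ₂)) ^ n) (delta G), delta G⟫_ℝ ≤
      convPow μ (2 * m) 1 + 4 ^ m * (1 - l / 2) ^ n := by
  rw [hμ.inner_affine_pow]
  set p := convPow μ (2 * m) 1 with hp
  have hp0 : 0 ≤ p := hμ.convPow_nonneg _ _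
  have hl : 0 ≤ 1 - l := by linarith
  have hle : ∀ j ∈ Finset.range (n + 1),
      l ^ j * (1 - l) ^ (n - j) * n.choose j * convPow μ j 1 ≤
        p * (l ^ j * (1 - l) ^ (n - j) * n.choose j) +
        4 ^ m * ((l / 2) ^ j * (1 - l) ^ (n - j) * n.choose j) := by
    intro j _
    have hA : 0 ≤ l ^ j * (1 - l) ^ (n - j) * n.choose j := by positivity
    by_cases hj : 2 * m ≤ j
    · have h2 := mul_le_mul_of_nonneg_left (hμ.convPow_le_even hj) hA
      have h3 : 0 ≤ 4 ^ m * ((l / 2) ^ j * (1 - l) ^ (n - j) * n.choose j) := by positivity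
      linarith
    · have h2 := mul_le_mul_of_nonneg_left (hμ.convPow_one_le_one j) hA
      have h3 : l ^ j ≤ 4 ^ m * (l / 2) ^ j := by
        rw [div_pow, ← mul_div_assoc, le_div_iff₀ (by positivity), mul_comm]
        refine mul_le_mul_of_nonneg_right ?_ (by positivity)
        rw [show (4 : ℝ) = 2 ^ 2 by norm_num, ← pow_mul]
        exact pow_le_pow_right₀ one_le_two (by omega)
      have h4 : l ^ j * ((1 - l) ^ (n - j) * n.choose j) ≤
          4 ^ m * (l / 2) ^ j * ((1 - l) ^ (n - j) * n.choose j) :=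
        mul_le_mul_of_nonneg_right h3 (by positivity)
      have h5 := mul_nonneg hp0 hA
      linarith
  refine (Finset.sum_le_sum hle).trans (le_of_eq ?_)
  rw [Finset.sum_add_distrib, ← Finset.mul_sum, ← Finset.mul_sum, ← add_pow, ← add_pow]
  have e1 : l + (1 - l) = 1 := by ring
  have e2 : l / 2 + (1 - l) = 1 - l / 2 := by ring
  rw [e1, e2, one_pow, mul_one]

theorem IsSymmLaw.half_convPow_le (hμ : IsSymmLaw μ) (hν : IsSymmLaw ν) {C : ℝ} (hC : 1 ≤ C)
    (h : ∀ f : G → ℝ, dirichlet μ f ≤ ENNReal.ofReal C * dirichlet ν f) (m k : ℕ) :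
    convPow ν (2 * k) 1 / 2 ≤
      convPow μ (2 * m) 1 + 4 ^ m * (1 - 1 / (4 * C)) ^ (2 * k + 1) := by
  have hC0 : 0 < C := by linarith
  -- This l turns the form inequality into l(1 - P_μ) ≤ (1 - P_ν)/2, that is, Y ≤ X for the two lazy
  -- operators.
  set l : ℝ := 1 / (2 * C) with hl
  have hl0 : 0 < l := by positivity
  have hl1 : l ≤ 1 := by
    rw [hl, div_le_one (by positivity)]
    linarith
  have h1 := hν.le_inner_half_pow k
  have h2 := hμ.inner_lazy_pow_le hl0.le hl1 m (2 * k + 1)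
  have hX : IsInvSymm (l • convOp μ + (1 - l) • (1 : ℓ₂ →L[ℝ] ℓ₂)) :=
    (hμ.isInvSymm.smul l).add (IsInvSymm.one.smul _)
  have hY : IsInvSymm ((1 / 2 : ℝ) • convOp ν + (1 / 2 : ℝ) • (1 : ℓ₂ →L[ℝ] ℓ₂)) :=
    (hν.isInvSymm.smul _).add (IsInvSymm.one.smul _)
  have h3 := hX.inner_odd_pow_le hY (fun f => ?_) k
  · have e : 1 - l / 2 = 1 - 1 / (4 * C) := by rw [hl]; field_simp; ring
    rw [e] at h2
    linarith
  · have h4 := h f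
    rw [hμ.dirichlet_eq, hν.dirichlet_eq, ← ENNReal.ofReal_mul hC0.le,
      ENNReal.ofReal_le_ofReal_iff (mul_nonneg hC0.le (sub_nonneg.2 (hν.inner_convOp_le f)))] at h4
    have h5 : l * (‖f‖ ^ 2 - ⟪convOp μ f, f⟫_ℝ) ≤ (‖f‖ ^ 2 - ⟪convOp ν f, f⟫_ℝ) / 2 := by
      have h6 := mul_le_mul_of_nonneg_left h4 hl0.le
      have h7 : l * (C * (‖f‖ ^ 2 - ⟪convOp ν f, f⟫_ℝ)) = (‖f‖ ^ 2 - ⟪convOp ν f, f⟫_ℝ) / 2 := by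
        rw [hl]; field_simp
      linarith
    simp only [add_apply, smul_apply, one_apply_eq_self, inner_add_left,
      real_inner_smul_left, real_inner_self_eq_norm_sq]
    linarith

/-- Comparison of return probabilities from comparison of Dirichlet forms. -/
theorem IsSymmLaw.exists_convPow_le (hμ : IsSymmLaw μ) (hν : IsSymmLaw ν) {C : ℝ}
    (h : ∀ f : G → ℝ, dirichlet μ f ≤ ENNReal.ofReal C * dirichlet ν f) :
    ∃ c : ℝ, 0 < c ∧ ∃ N : ℕ, 1 ≤ N ∧ ∀ n : ℕ,
      c * convPow ν (2 * N * n) 1 ≤ convPow μ (2 * n) 1 := by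
  set D := max C 1 with hD
  have hD1 : 1 ≤ D := le_max_right _ _
  have h' : ∀ f : G → ℝ, dirichlet μ f ≤ ENNReal.ofReal D * dirichlet ν f := fun f =>
    (h f).trans (mul_le_mul_left (ENNReal.ofReal_le_ofReal (le_max_left _ _)) _)
  have hμ2 := hμ.convPow_two_pos
  have hμ2' := hμ.convPow_one_le_one 2
  set b : ℝ := 1 - 1 / (4 * D) with hb
  have hb0 : 0 ≤ b := by
    rw [hb, sub_nonneg, div_le_one (by positivity)]
    linarith
  have hb1 : b < 1 := by
    have : 0 < 1 / (4 * D) := by positivity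
    linarith
  -- Running ν for 2Jm steps makes the error 4^m b^(2Jm+1) at most 2^(-m), while θ^J ≥ 3/4 keeps a
  -- lower bound θ^(Jm) well above it.
  obtain ⟨J, hJ⟩ := exists_pow_lt_of_lt_one (by norm_num : (0 : ℝ) < 1 / 8) hb1
  have hJ1 : 1 ≤ J := by
    by_contra hJ0
    rw [Nat.lt_one_iff.1 (not_le.1 hJ0)] at hJ
    norm_num at hJ
  have hJ' : (1 : ℝ) ≤ J := by exact_mod_cast hJ1
  set θ : ℝ := 1 - 1 / (4 * J) with hθ
  have hθ0 : 0 < θ := by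
    rw [hθ, sub_pos, div_lt_one (by positivity)]
    linarith
  have hθ1 : θ < 1 := by
    have : (0 : ℝ) < 1 / (4 * J) := by positivity
    linarith
  have hθJ : 3 / 4 ≤ θ ^ J := by
    have h1 := one_add_mul_le_pow (a := -(1 / (4 * (J : ℝ)))) (by
      have : 1 / (4 * (J : ℝ)) ≤ 1 := by
        rw [div_le_one (by positivity)]
        linarith
      linarith) J
    have h2 : 1 + (J : ℝ) * -(1 / (4 * J)) = 3 / 4 := by field_simp; norm_num
    rw [h2, ← sub_eq_add_neg] at h1
    exact h1
  -- Either ν returns at rate at least θ at a single time 2m₀, which supermultiplicativity and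
  -- monotonicity extend to all times, or its return probabilities are below θ^m throughout.
  by_cases hcase : ∃ m₀ : ℕ, 1 ≤ m₀ ∧ θ ^ m₀ ≤ convPow ν (2 * m₀) 1
  · obtain ⟨m₀, hm₀, hq⟩ := hcase
    have hlow (m : ℕ) : θ ^ m₀ * θ ^ m ≤ convPow ν (2 * m) 1 := by
      set t := m / m₀ + 1 with ht
      have h1 : m ≤ m₀ * t := by
        rw [ht, mul_add, mul_one]
        exact (Nat.lt_mul_div_succ m hm₀).le
      have h2 : m₀ * t ≤ m₀ + m := by
        rw [ht, mul_add, mul_one, add_comm]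
        exact Nat.add_le_add_left (Nat.mul_div_le m m₀) _
      calc θ ^ m₀ * θ ^ m = θ ^ (m₀ + m) := (pow_add _ _ _).symm
        _ ≤ θ ^ (m₀ * t) := pow_le_pow_of_le_one hθ0.le hθ1.le h2
        _ = (θ ^ m₀) ^ t := pow_mul _ _ _
        _ ≤ convPow ν (2 * m₀) 1 ^ t := pow_le_pow_left₀ (by positivity) hq t
        _ ≤ convPow ν (2 * (m₀ * t)) 1 := hν.pow_convPow_le m₀ t
        _ ≤ _ := hν.convPow_le_even (by omega)
    obtain ⟨m₁, hm₁⟩ := exists_pow_lt_of_lt_one (by positivity : (0 : ℝ) < θ ^ m₀ / 4)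
      (by norm_num : (2 / 3 : ℝ) < 1)
    -- From m₁ on the error is at most a quarter of the return probability of ν, which leaves 1/4 of
    -- the initial 1/2. For smaller m the lower bound μ^{(2)}(e)^m is enough.
    refine ⟨min (1 / 4) (convPow μ 2 1 ^ m₁), by positivity, J, hJ1, fun m => ?_⟩
    have hq0 := hν.convPow_nonneg (2 * (J * m)) 1
    rw [mul_assoc]
    rcases le_total m₁ m with hm | hm
    · have h1 := hμ.half_convPow_le hν hD1 h' m (J * m)
      have h2 : (4 : ℝ) ^ m * b ^ (2 * (J * m) + 1) ≤ (1 / 2) ^ m := by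
        have h3 : b ^ (2 * (J * m) + 1) ≤ (b ^ J) ^ m := by
          rw [← pow_mul]
          exact pow_le_pow_of_le_one hb0 hb1.le (by omega)
        have h4 : (b ^ J) ^ m ≤ (1 / 8) ^ m := pow_le_pow_left₀ (by positivity) hJ.le m
        calc (4 : ℝ) ^ m * b ^ (2 * (J * m) + 1) ≤ 4 ^ m * (1 / 8) ^ m :=
              mul_le_mul_of_nonneg_left (h3.trans h4) (by positivity)
          _ = (1 / 2) ^ m := by rw [← mul_pow]; norm_num
      have h3 : (1 / 2 : ℝ) ^ m ≤ convPow ν (2 * (J * m)) 1 / 4 := by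
        have h4 : (2 / 3 : ℝ) ^ m ≤ θ ^ m₀ / 4 :=
          (pow_le_pow_of_le_one (by norm_num) (by norm_num) hm).trans hm₁.le
        have h5 : (3 / 4 : ℝ) ^ m ≤ θ ^ (J * m) := by
          rw [pow_mul]
          exact pow_le_pow_left₀ (by norm_num) hθJ m
        calc (1 / 2 : ℝ) ^ m = (2 / 3) ^ m * (3 / 4) ^ m := by rw [← mul_pow]; norm_num
          _ ≤ θ ^ m₀ / 4 * θ ^ (J * m) := mul_le_mul h4 h5 (by positivity) (by positivity)
          _ = θ ^ m₀ * θ ^ (J * m) / 4 := by ring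
          _ ≤ _ := by linarith [hlow (J * m)]
      have h4 := mul_le_mul_of_nonneg_right (min_le_left (1 / 4) (convPow μ 2 1 ^ m₁)) hq0
      linarith
    · have h1 := hμ.pow_convPow_le 1 m
      rw [mul_one, one_mul] at h1
      refine le_trans ?_ h1
      refine (mul_le_mul (min_le_right _ _) (hν.convPow_one_le_one _) hq0 (by positivity)).trans ?_
      rw [mul_one]
      exact pow_le_pow_of_le_one hμ2.le hμ2' hm
  · push Not at hcase
    -- Exponential decay of ν: enough steps of ν bring θ^(N+1) below μ^{(2)}(e).
    obtain ⟨N, hN⟩ := exists_pow_lt_of_lt_one hμ2 hθ1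
    refine ⟨1, one_pos, N + 1, by omega, fun m => ?_⟩
    rw [one_mul]
    rcases Nat.eq_zero_or_pos m with rfl | hm
    · simp [convPow_zero_one]
    · have h1 := hcase ((N + 1) * m) (by nlinarith)
      have h2 := hμ.pow_convPow_le 1 m
      rw [mul_one, one_mul] at h2
      rw [mul_assoc]
      refine h1.le.trans (le_trans ?_ h2)
      rw [pow_mul]
      refine pow_le_pow_left₀ (by positivity) ?_ m
      exact (pow_le_pow_of_le_one hθ0.le hθ1.le (Nat.le_succ N)).trans hN.le

end ConvolutionOperators
end NilWalk

/-! ### Comparison of one-dimensional steps with the radial measure -/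

namespace NilWalk
open FormalComm

section StepComparison

/-- For n₀ in S, the set has at most 2K|n₀| + 1 ≤ 3K|n₀| elements, each of weight at most K/|n₀|. -/
theorem tsum_indicator_inv_le (S : Set ℤ) {K : ℝ} (hK : 1 ≤ K) (h1 : ∀ n ∈ S, 1 ≤ |(n : ℝ)|)
    (h : ∀ n ∈ S, ∀ m ∈ S, |(m : ℝ)| ≤ K * |(n : ℝ)|) :
    ∑' n, S.indicator (fun n : ℤ => ENNReal.ofReal (1 / (1 + |(n : ℝ)|))) n ≤
      ENNReal.ofReal (3 * K ^ 2) := by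
  rcases S.eq_empty_or_nonempty with rfl | ⟨n₀, hn₀⟩
  · simp
  have h0 := h1 n₀ hn₀
  set M : ℕ := ⌊K * |(n₀ : ℝ)|⌋₊ with hM
  have hsub : ∀ n ∉ Finset.Icc (-(M : ℤ)) M,
      S.indicator (fun n : ℤ => ENNReal.ofReal (1 / (1 + |(n : ℝ)|))) n = 0 := by
    intro n hn
    refine Set.indicator_of_notMem (fun hS => hn ?_) _
    rw [Finset.mem_Icc, ← abs_le]
    have h2 : (n.natAbs : ℝ) ≤ K * |(n₀ : ℝ)| := by
      rw [Nat.cast_natAbs, Int.cast_abs]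
      exact h n₀ hn₀ n hS
    have h3 : n.natAbs ≤ M := Nat.le_floor h2
    rw [Int.abs_eq_natAbs]
    exact_mod_cast h3
  rw [tsum_eq_sum hsub]
  have hle : ∀ n ∈ Finset.Icc (-(M : ℤ)) M,
      S.indicator (fun n : ℤ => ENNReal.ofReal (1 / (1 + |(n : ℝ)|))) n ≤
        ENNReal.ofReal (K / |(n₀ : ℝ)|) := by
    intro n _
    by_cases hS : n ∈ S
    · rw [Set.indicator_of_mem hS]
      refine ENNReal.ofReal_le_ofReal ?_
      rw [div_le_div_iff₀ (by positivity) (by linarith)]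
      have := h n hS n₀ hn₀
      nlinarith
    · rw [Set.indicator_of_notMem hS]
      exact zero_le
  refine (Finset.sum_le_card_nsmul _ _ _ hle).trans ?_
  rw [← ENNReal.ofReal_nsmul]
  refine ENNReal.ofReal_le_ofReal ?_
  have hcard : (Finset.Icc (-(M : ℤ)) M).card = 2 * M + 1 := by
    rw [Int.card_Icc]; omega
  have hMle : (M : ℝ) ≤ K * |(n₀ : ℝ)| := Nat.floor_le (by positivity)
  rw [hcard, nsmul_eq_mul, mul_div_assoc', div_le_iff₀ (by linarith)]
  push_cast
  nlinarith

variable {G : Type*} [Group G] {k : ℕ} {s : Fin k → G} {F : Fin k → ℝ → ℝ} {φ : ℝ → ℝ}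
  {c₀ c₁ : FormalComm k}

theorem stepWeight_pos (hF : ∀ i, IsIncreasing (F i)) (hφpos : ∀ t, 0 ≤ t → 0 < φ t)
    (c₁ : FormalComm k) {f : ℝ → ℝ} (hf : ∀ t, ∃ r, 1 ≤ r ∧ t ≤ f r) (n : ℤ) :
    0 < stepWeight φ (c₁.weightFun F) f n := by
  have h1 := one_le_weightFun hF c₁ (one_le_genInv (hf |(n : ℝ)|))
  have h2 := hφpos _ (zero_le_one.trans h1)
  unfold stepWeight
  positivity

/-- Averaging over a translate of a ball. -/
theorem mul_le_tsum_indicator [Group.IsNilpotent G] (hF : ∀ i, IsIncreasing (F i)) {ρ : ℝ}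
    (hρ : 1 ≤ ρ) {E : Set G} {v z : G} (hzE : ∀ y ∈ comBall s F ρ, z * y ∈ E)
    (hvE : ∀ y ∈ comBall s F ρ, v * (z * y) ∈ E) {α κ : ℝ} (hκ : 0 ≤ κ) {r : G → ℝ}
    (hα : ∀ x ∈ E, α ≤ κ * (comBall s F ρ).ncard * r x) {Δ : G → ℝ≥0∞}
    (hΔ : ∀ u y, Δ u ≤ 2 * (Δ y + Δ (u * y))) :
    ENNReal.ofReal α * Δ v ≤ ENNReal.ofReal κ *
      (4 * ∑' x, E.indicator (fun x => ENNReal.ofReal (r x) * Δ x) x) := by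
  classical
  set A := (finite_comBall (s := s) (F := F) ρ).toFinset with hA
  set h := E.indicator (fun x => ENNReal.ofReal (r x) * Δ x) with hh
  have hcard : A.card = (comBall s F ρ).ncard := (Set.ncard_eq_toFinset_card _ _).symm
  have hcard0 : (A.card : ℝ≥0∞) ≠ 0 := by
    rw [hcard]; exact_mod_cast (ncard_comBall_pos hF hρ).ne'
  have hE : ∀ x ∈ E, ENNReal.ofReal α * Δ x ≤ A.card * ENNReal.ofReal κ * h x := by
    intro x hx
    have he : (A.card : ℝ≥0∞) * ENNReal.ofReal κ * ENNReal.ofReal (r x) =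
        ENNReal.ofReal (κ * (comBall s F ρ).ncard * r x) := by
      rw [← ENNReal.ofReal_natCast, ← ENNReal.ofReal_mul (Nat.cast_nonneg _),
        ← ENNReal.ofReal_mul (by positivity), hcard, mul_comm κ]
    rw [hh, Set.indicator_of_mem hx, ← mul_assoc, he]
    gcongr
    exact hα x hx
  have htrans (g : G) : ∑ y ∈ A, h (g * y) ≤ ∑' x, h x :=
    (ENNReal.sum_le_tsum _).trans_eq ((Equiv.mulLeft g).tsum_eq h)
  -- The inequality for Δ is summed over y ∈ B(ρ) and the factor |B(ρ)| cancelled; left translation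
  -- by z and by vz is injective, so each of the two sums is at most the sum over E.
  have main : (A.card : ℝ≥0∞) * (ENNReal.ofReal α * Δ v) ≤
      A.card * (ENNReal.ofReal κ * (4 * ∑' x, h x)) := by
    calc (A.card : ℝ≥0∞) * (ENNReal.ofReal α * Δ v) = ∑ y ∈ A, ENNReal.ofReal α * Δ v := by
          rw [Finset.sum_const, nsmul_eq_mul]
      _ ≤ ∑ y ∈ A, 2 * (A.card * ENNReal.ofReal κ) * (h (z * y) + h (v * z * y)) := by
          refine Finset.sum_le_sum fun y hy => ?_
          have hy' : y ∈ comBall s F ρ := by simpa [hA] using hy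
          have h1 := hE _ (hzE y hy')
          have h2 := hE _ (hvE y hy')
          calc ENNReal.ofReal α * Δ v
              ≤ ENNReal.ofReal α * (2 * (Δ (z * y) + Δ (v * (z * y)))) := by
                gcongr; exact hΔ v (z * y)
            _ = 2 * (ENNReal.ofReal α * Δ (z * y) + ENNReal.ofReal α * Δ (v * (z * y))) := by ring
            _ ≤ 2 * (A.card * ENNReal.ofReal κ * h (z * y) +
                  A.card * ENNReal.ofReal κ * h (v * (z * y))) := by gcongr
            _ = _ := by rw [mul_assoc v z y]; ring
      _ = 2 * (A.card * ENNReal.ofReal κ) *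
            (∑ y ∈ A, h (z * y) + ∑ y ∈ A, h (v * z * y)) := by
          rw [← Finset.mul_sum, Finset.sum_add_distrib]
      _ ≤ 2 * (A.card * ENNReal.ofReal κ) * (∑' x, h x + ∑' x, h x) := by
          gcongr <;> exact htrans _
      _ = _ := by ring
  exact (ENNReal.mul_le_mul_iff_right hcard0 (ENNReal.natCast_ne_top _)).1 main

/-- Comparison of the one-dimensional steps along `s_i` with the radial measure. The functionals
`Δ` of interest are `1` and `y ↦ ∑ x, |f (x y) - f x| ^ 2`. -/
theorem exists_tsum_stepWeight_le [Group.IsNilpotent G]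
    (hs : Subgroup.closure (Set.range s) = ⊤)
    (hF : ∀ i, IsIncreasing (F i)) (hF1 : IsDoublingSystem F)
    (h01 : ∃ C : ℝ, 1 ≤ C ∧ ∀ r, 1 ≤ r → c₀.weightFun F r ≤ C * c₁.weightFun F r)
    (h10 : ∃ C : ℝ, 1 ≤ C ∧ ∀ r, 1 ≤ r → c₁.weightFun F r ≤ C * c₀.weightFun F r)
    (hφpos : ∀ t, 0 ≤ t → 0 < φ t)
    (hφdoub : ∃ C : ℝ, ∀ l ∈ Set.Ioo (1 / 2 : ℝ) 2, ∀ t, 0 < t → φ t ≤ C * φ (l * t))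
    {i : Fin k} (hi : ¬ IsOfFinOrder (s i)) {f : ℝ → ℝ} (hf : IsIncreasing f)
    {c : FormalComm k} (hfc : Simeq f (c.weightFun F)) {u : ℕ} (hu : 1 ≤ u)
    {ω : List (FormalComm k)} (hω : evalWord s ω = s i ^ u) {C : ℝ}
    (hC : ∀ x ∈ ω, ∀ r, 1 ≤ r → c.weightFun F r ≤ C * x.weightFun F r) :
    ∃ K : ℝ≥0∞, K ≠ ⊤ ∧ ∀ Δ : G → ℝ≥0∞, (∀ u y, Δ u ≤ 2 * (Δ y + Δ (u * y))) →
      ∑' n : ℤ, ENNReal.ofReal (stepWeight φ (c₁.weightFun F) f n) * Δ (s i ^ n) ≤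
        K * ∑' y, ENNReal.ofReal (radialWeight φ (comNorm s F c₀) y) * Δ y := by
  have hne := exists_le_of_simeq hF hF1 hfc
  obtain ⟨K₁, T₁, hK₁, hT₁⟩ := exists_le_weightFun_genInv hF hF1 hf hfc
  -- The bound on exponents is K₁ F_c rather than f: at ρ = f⁻¹(|n|) only |n| ≤ K₁ F_c(ρ) is
  -- available.
  obtain ⟨a, ha, hpow⟩ := exists_zpow_mem_comBall hF hF1 (f := fun r => K₁ * c.weightFun F r) hu hω
    (C := K₁ * C) (fun x hx r hr => by
      rw [mul_assoc]; exact mul_le_mul_of_nonneg_left (hC x hx r hr) hK₁.le)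
  obtain ⟨b, hb, hz⟩ := exists_pow_mem_annulus hF hF1 hi ha
  obtain ⟨K₂, T₂, hK₂, hT₂⟩ := exists_le_mul_of_genInv_le hF hF1 hf hfc hb
  obtain ⟨K₃, hK₃, hrad⟩ := exists_le_radialWeight hs hF hF1 h01 h10 hφpos hφdoub hb
  set T : ℝ := max 1 (max T₁ T₂) with hT
  set r : G → ℝ := radialWeight φ (comNorm s F c₀) with hr
  have hrpos : ∀ x, 0 < r x := radialWeight_pos hs hF hF1 hφpos c₀
  set st : ℤ → ℝ := stepWeight φ (c₁.weightFun F) f with hst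
  set ρ : ℤ → ℝ := fun n => genInv f |(n : ℝ)| with hρ
  have hρ1 : ∀ n, 1 ≤ ρ n := fun n => one_le_genInv (hne _)
  set E : ℤ → Set G := fun n => comBall s F (b * ρ n) \ comBall s F (ρ n) with hE
  have hfar (Δ : G → ℝ≥0∞) (hΔ : ∀ u y, Δ u ≤ 2 * (Δ y + Δ (u * y))) (n : ℤ)
      (hn : T ≤ |(n : ℝ)|) : ENNReal.ofReal (st n) * Δ (s i ^ n) ≤
        ENNReal.ofReal (K₃ * (1 / (1 + |(n : ℝ)|))) *
          (4 * ∑' x, (E n).indicator (fun x => ENNReal.ofReal (r x) * Δ x) x) := by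
    obtain ⟨z, hz⟩ := hz (ρ n) (hρ1 n)
    have haρ : 1 ≤ a * ρ n := one_le_mul_of_one_le_of_one_le ha (hρ1 n)
    have hv : s i ^ n ∈ comBall s F (a * ρ n) :=
      hpow (ρ n) (hρ1 n) n (hT₁ _ (((le_max_left _ _).trans (le_max_right _ _)).trans hn))
    refine mul_le_tsum_indicator hF (hρ1 n) (fun y hy => ?_) (fun y hy => hz y hy _ hv)
      (by positivity) (fun x hx => ?_) hΔ
    -- The case v = 1 places zy itself in the annulus.
    · simpa using hz y hy 1 (one_mem_comBall hF haρ)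
    · have h1 := hrad (ρ n) (hρ1 n) x hx
      have h2 : st n = 1 / (1 + |(n : ℝ)|) * (1 / φ (c₁.weightFun F (ρ n))) := by
        rw [hst, one_div_mul_one_div]; rfl
      rw [h2]
      calc 1 / (1 + |(n : ℝ)|) * (1 / φ (c₁.weightFun F (ρ n)))
          ≤ 1 / (1 + |(n : ℝ)|) * (K₃ * (comBall s F (ρ n)).ncard * r x) :=
            mul_le_mul_of_nonneg_left h1 (by positivity)
        _ = _ := by ring
  -- If x lies in E_n and E_m, then ρ_m ≤ bρ_n, since otherwise x ∈ B(bρ_n) ⊆ B(ρ_m); hence |m| ≤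
  -- K₂|n|.
  have hoverlap (x : G) : ∑' n, {n : ℤ | T ≤ |(n : ℝ)| ∧ x ∈ E n}.indicator
      (fun n : ℤ => ENNReal.ofReal (1 / (1 + |(n : ℝ)|))) n ≤ ENNReal.ofReal (3 * K₂ ^ 2) := by
    refine tsum_indicator_inv_le _ hK₂ (fun n hn => (le_max_left _ _).trans hn.1) ?_
    rintro n ⟨hn, hxn⟩ m ⟨hm, hxm⟩
    refine hT₂ _ (((le_max_right _ _).trans (le_max_right _ _)).trans hn) _ (not_lt.1 fun hlt => ?_)
    exact hxm.2 (comBall_mono hF (one_le_mul_of_one_le_of_one_le hb (hρ1 n)) hlt.le hxn.1)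
  -- The finitely many small n are compared with the single term of the radial sum at s_i^n, whose
  -- weight is positive.
  set near : ℤ → ℝ≥0∞ := fun n => if |(n : ℝ)| < T then
    ENNReal.ofReal (st n) * (ENNReal.ofReal (r (s i ^ n)))⁻¹ else 0 with hnear
  have hnear_top : ∑' n, near n ≠ ⊤ := by
    rw [tsum_eq_sum (s := Finset.Icc (-⌈T⌉) ⌈T⌉)]
    · refine (ENNReal.sum_lt_top.2 fun n _ => ?_).ne
      simp only [hnear]
      split_ifs
      · exact ENNReal.mul_lt_top ENNReal.ofReal_lt_top
          (ENNReal.inv_lt_top.2 (ENNReal.ofReal_pos.2 (hrpos _)))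
      · exact ENNReal.zero_lt_top
    · intro n hn
      refine if_neg fun hlt => hn ?_
      rw [Finset.mem_Icc, ← abs_le]
      have : ((|n| : ℤ) : ℝ) ≤ (⌈T⌉ : ℤ) := by
        rw [Int.cast_abs]; exact hlt.le.trans (Int.le_ceil T)
      exact_mod_cast this
  refine ⟨∑' n, near n + 4 * ENNReal.ofReal K₃ * ENNReal.ofReal (3 * K₂ ^ 2), ?_, fun Δ hΔ => ?_⟩
  · exact ENNReal.add_ne_top.2 ⟨hnear_top, ENNReal.mul_ne_top
      (ENNReal.mul_ne_top (by norm_num) ENNReal.ofReal_ne_top) ENNReal.ofReal_ne_top⟩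
  set g : G → ℝ≥0∞ := fun x => ENNReal.ofReal (r x) * Δ x with hg
  have hterm (n : ℤ) : ENNReal.ofReal (st n) * Δ (s i ^ n) ≤
      near n * ∑' x, g x + 4 * ENNReal.ofReal K₃ * ∑' x, {n : ℤ | T ≤ |(n : ℝ)| ∧ x ∈ E n}.indicator
      (fun n : ℤ => ENNReal.ofReal (1 / (1 + |(n : ℝ)|))) n * g x := by
    by_cases hn : |(n : ℝ)| < T
    · refine le_trans ?_ le_self_add
      have h1 : g (s i ^ n) ≤ ∑' x, g x := ENNReal.le_tsum _
      have h2 : ENNReal.ofReal (r (s i ^ n)) ≠ 0 := (ENNReal.ofReal_pos.2 (hrpos _)).ne'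
      calc ENNReal.ofReal (st n) * Δ (s i ^ n)
          = near n * g (s i ^ n) := by
            simp only [hnear, if_pos hn, hg]
            rw [mul_assoc, ← mul_assoc _ (ENNReal.ofReal (r (s i ^ n))),
              ENNReal.inv_mul_cancel h2 ENNReal.ofReal_ne_top, one_mul]
        _ ≤ _ := by gcongr
    · refine le_trans (hfar Δ hΔ n (not_lt.1 hn)) (le_trans (le_of_eq ?_) le_add_self)
      rw [ENNReal.ofReal_mul hK₃.le]
      have h1 : ∀ x, {n : ℤ | T ≤ |(n : ℝ)| ∧ x ∈ E n}.indicator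
          (fun n : ℤ => ENNReal.ofReal (1 / (1 + |(n : ℝ)|))) n * g x =
          ENNReal.ofReal (1 / (1 + |(n : ℝ)|)) * (E n).indicator g x := by
        intro x
        by_cases hx : x ∈ E n
        · rw [Set.indicator_of_mem hx,
            Set.indicator_of_mem (show n ∈ {n : ℤ | T ≤ |(n : ℝ)| ∧ x ∈ E n} from ⟨not_lt.1 hn, hx⟩)]
        · rw [Set.indicator_of_notMem hx, Set.indicator_of_notMem (fun h => hx h.2)]
          simp
      simp only [h1, ENNReal.tsum_mul_left]
      ring
  refine (ENNReal.tsum_le_tsum hterm).trans ?_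
  rw [ENNReal.tsum_add, ENNReal.tsum_mul_right, ENNReal.tsum_mul_left, ENNReal.tsum_comm, add_mul,
    mul_assoc (4 * ENNReal.ofReal K₃)]
  gcongr
  rw [← ENNReal.tsum_mul_left]
  refine ENNReal.tsum_le_tsum fun x => ?_
  rw [ENNReal.tsum_mul_right]
  gcongr
  exact hoverlap x

end StepComparison
end NilWalk

/-! ### Increments, mixtures and generators of finite order -/

namespace NilWalk
open FormalComm

section Mixtures

variable {G : Type*} [Group G] {k : ℕ} {s : Fin k → G} {p : Fin k → ℤ → ℝ}

/-- The increment `∑ x, |f (x y) - f x| ^ 2`. -/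
noncomputable def increment (f : G → ℝ) (y : G) : ℝ≥0∞ :=
  ∑' x, ENNReal.ofReal (|f (x * y) - f x| ^ 2)

/-- f(xu) - f(x) is the difference of f(xuy) - f(x) and f(xuy) - f(xu), and (p - q)² ≤ 2p² + 2q²;
the sum over x is invariant under x ↦ xu. -/
theorem increment_le (f : G → ℝ) (u y : G) :
    increment f u ≤ 2 * (increment f y + increment f (u * y)) := by
  have h : increment f y = ∑' x, ENNReal.ofReal (|f (x * u * y) - f (x * u)| ^ 2) :=
    ((Equiv.mulRight u).tsum_eq fun x => ENNReal.ofReal (|f (x * y) - f x| ^ 2)).symm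
  rw [h, increment, increment, ← ENNReal.tsum_add, ← ENNReal.tsum_mul_left]
  refine ENNReal.tsum_le_tsum fun x => ?_
  rw [← ENNReal.ofReal_add (by positivity) (by positivity),
    show (2 : ℝ≥0∞) = ENNReal.ofReal 2 by simp, ← ENNReal.ofReal_mul (by norm_num)]
  refine ENNReal.ofReal_le_ofReal ?_
  rw [sq_abs, sq_abs, sq_abs, mul_assoc]
  nlinarith [sq_nonneg (f (x * (u * y)) - f (x * u) + (f (x * (u * y)) - f x))]

theorem dirichlet_eq_tsum_increment (μ f : G → ℝ) :
    dirichlet μ f = 1 / 2 * ∑' y, ENNReal.ofReal (μ y) * increment f y := by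
  unfold dirichlet increment
  rw [ENNReal.tsum_comm]
  congr 1
  refine tsum_congr fun y => ?_
  rw [← ENNReal.tsum_mul_left]
  refine tsum_congr fun x => ?_
  rw [ENNReal.ofReal_mul (by positivity), mul_comm]

open Classical in
theorem hasSum_pushforward {p : ℤ → ℝ} (hp : HasSum p 1) (a : G) :
    HasSum (fun g => ∑' n : ℤ, if a ^ n = g then p n else 0) 1 := by
  refine (hp.tsum_fiberwise fun n => a ^ n).congr_fun fun g => ?_
  rw [tsum_subtype]
  refine tsum_congr fun n => ?_
  simp [Set.indicator_apply]

theorem isSymmLaw_mixture (hk : 0 < k) (hp : ∀ i, IsSymmProb (p i)) : IsSymmLaw (mixture s p) where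
  nonneg g := by
    classical
    refine mul_nonneg (by positivity) (Finset.sum_nonneg fun i _ => tsum_nonneg fun n => ?_)
    split_ifs
    · exact (hp i).1 n
    · exact le_rfl
  symm g := by
    classical
    unfold mixture
    congr 1
    refine Finset.sum_congr rfl fun i _ => ?_
    rw [← (Equiv.neg ℤ).tsum_eq]
    refine tsum_congr fun n => ?_
    have h : s i ^ (-n) = g⁻¹ ↔ s i ^ n = g := by rw [zpow_neg, inv_inj]
    change (if s i ^ (-n) = g⁻¹ then p i (-n) else 0) = _
    rw [(hp i).2.1 n]
    by_cases hn : s i ^ n = g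
    · rw [if_pos hn, if_pos (h.2 hn)]
    · rw [if_neg hn, if_neg fun h' => hn (h.1 h')]
  hasSum := by
    classical
    have h := (hasSum_sum (s := Finset.univ) fun i _ =>
      hasSum_pushforward (hp i).2.2 (s i)).mul_left (1 / (k : ℝ))
    have hk' : (k : ℝ) ≠ 0 := by exact_mod_cast hk.ne'
    have e : 1 / (k : ℝ) * ∑ i : Fin k, (1 : ℝ) = 1 := by simp [hk']
    rw [e] at h
    exact h

theorem tsum_mixture_mul (hp : ∀ i, IsSymmProb (p i)) (Δ : G → ℝ≥0∞) :
    ∑' y, ENNReal.ofReal (mixture s p y) * Δ y =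
      ENNReal.ofReal (1 / k) * ∑ i, ∑' n : ℤ, ENNReal.ofReal (p i n) * Δ (s i ^ n) := by
  classical
  have hnn (i : Fin k) (y : G) (n : ℤ) : 0 ≤ if s i ^ n = y then p i n else 0 := by
    split_ifs
    · exact (hp i).1 n
    · exact le_rfl
  have hsum (i : Fin k) (y : G) : Summable fun n : ℤ => if s i ^ n = y then p i n else 0 :=
    Summable.of_nonneg_of_le (hnn i y) (fun n => by
      split_ifs
      · exact le_rfl
      · exact (hp i).1 n) (hp i).2.2.summable
  have h1 (y : G) : ENNReal.ofReal (mixture s p y) * Δ y =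
      ENNReal.ofReal (1 / k) * ∑ i, ∑' n : ℤ, (if s i ^ n = y then ENNReal.ofReal (p i n) else 0) *
        Δ y := by
    unfold mixture
    rw [ENNReal.ofReal_mul (by positivity),
      ENNReal.ofReal_sum_of_nonneg fun i _ => tsum_nonneg (hnn i y), mul_assoc, Finset.sum_mul]
    congr 1
    refine Finset.sum_congr rfl fun i _ => ?_
    rw [ENNReal.ofReal_tsum_of_nonneg (hnn i y) (hsum i y), ENNReal.tsum_mul_right]
    congr 1
    refine tsum_congr fun n => ?_
    split_ifs <;> simp
  simp only [h1]
  rw [ENNReal.tsum_mul_left]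
  congr 1
  rw [Summable.tsum_finsetSum fun _ _ => ENNReal.summable]
  refine Finset.sum_congr rfl fun i _ => ?_
  rw [ENNReal.tsum_comm]
  refine tsum_congr fun n => ?_
  rw [tsum_eq_single (s i ^ n) fun y hy => by rw [if_neg hy.symm, zero_mul], if_pos rfl]

theorem isSymmLaw_radialMeasure {φ : ℝ → ℝ} {N : G → ℝ} (hN : ∀ g, N g⁻¹ = N g)
    (hpos : ∀ g, 0 < radialWeight φ N g) (hsum : Summable (radialWeight φ N)) :
    IsSymmLaw (radialMeasure φ N) where
  nonneg g := mul_nonneg (inv_nonneg.2 (tsum_nonneg fun x => (hpos x).le)) (hpos g).le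
  symm g := by simp only [radialMeasure, radialWeight, hN]
  hasSum := by
    have h := hsum.hasSum.mul_left (∑' x, radialWeight φ N x)⁻¹
    have hne : 0 < ∑' x, radialWeight φ N x := hsum.tsum_pos (fun x => (hpos x).le) 1 (hpos 1)
    rw [inv_mul_cancel₀ hne.ne'] at h
    exact h

theorem isSymmProb_stepWeight {φ F₁ F₂ : ℝ → ℝ} (hpos : ∀ n, 0 < stepWeight φ F₁ F₂ n)
    (hsum : Summable (stepWeight φ F₁ F₂)) {p : ℤ → ℝ}
    (hp : ∀ n, p n = (∑' m, stepWeight φ F₁ F₂ m)⁻¹ * stepWeight φ F₁ F₂ n) : IsSymmProb p := by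
  have hne : 0 < ∑' x, stepWeight φ F₁ F₂ x := hsum.tsum_pos (fun x => (hpos x).le) 1 (hpos 1)
  refine ⟨fun n => ?_, fun n => ?_, ?_⟩
  · rw [hp]
    exact mul_nonneg (inv_nonneg.2 hne.le) (hpos n).le
  · rw [hp, hp]
    simp [stepWeight]
  · have h := hsum.hasSum.mul_left (∑' x, stepWeight φ F₁ F₂ x)⁻¹
    rw [inv_mul_cancel₀ hne.ne'] at h
    rw [funext hp]
    exact h

/-- The powers of a are finitely many points of positive weight, so each Δ(a^n) is bounded by K
times the full sum, whatever the law p. -/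
theorem exists_tsum_le_of_isOfFinOrder {p : ℤ → ℝ} (hp : IsSymmProb p) {a : G}
    (ha : IsOfFinOrder a) {r : G → ℝ} (hr : ∀ x, 0 < r x) :
    ∃ K : ℝ≥0∞, K ≠ ⊤ ∧ ∀ Δ : G → ℝ≥0∞,
      ∑' n : ℤ, ENNReal.ofReal (p n) * Δ (a ^ n) ≤ K * ∑' y, ENNReal.ofReal (r y) * Δ y := by
  have hfin : (Subgroup.zpowers a : Set G).Finite := finite_zpowers.2 ha
  set K := ∑ y ∈ hfin.toFinset, (ENNReal.ofReal (r y))⁻¹ with hK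
  refine ⟨K, ?_, fun Δ => ?_⟩
  · exact (ENNReal.sum_lt_top.2 fun y _ => ENNReal.inv_lt_top.2 (ENNReal.ofReal_pos.2 (hr y))).ne
  · have h1 (n : ℤ) : Δ (a ^ n) ≤ K * ∑' y, ENNReal.ofReal (r y) * Δ y := by
      have h2 : ENNReal.ofReal (r (a ^ n)) * Δ (a ^ n) ≤ ∑' y, ENNReal.ofReal (r y) * Δ y :=
        ENNReal.le_tsum (f := fun y => ENNReal.ofReal (r y) * Δ y) _
      have h3 : (ENNReal.ofReal (r (a ^ n)))⁻¹ ≤ K :=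
        Finset.single_le_sum (f := fun y => (ENNReal.ofReal (r y))⁻¹) (fun _ _ => zero_le)
          (hfin.mem_toFinset.2 (Subgroup.zpow_mem_zpowers a n))
      calc Δ (a ^ n) = (ENNReal.ofReal (r (a ^ n)))⁻¹ * (ENNReal.ofReal (r (a ^ n)) * Δ (a ^ n)) := by
            rw [← mul_assoc, ENNReal.inv_mul_cancel (ENNReal.ofReal_pos.2 (hr _)).ne'
              ENNReal.ofReal_ne_top, one_mul]
        _ ≤ _ := mul_le_mul' h3 h2
    calc ∑' n : ℤ, ENNReal.ofReal (p n) * Δ (a ^ n)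
        ≤ ∑' n : ℤ, ENNReal.ofReal (p n) * (K * ∑' y, ENNReal.ofReal (r y) * Δ y) := by
          gcongr with n; exact h1 n
      _ = _ := by
          rw [ENNReal.tsum_mul_right, ← ENNReal.ofReal_tsum_of_nonneg hp.1 hp.2.2.summable,
            hp.2.2.tsum_eq, ENNReal.ofReal_one, one_mul]

end Mixtures

theorem exists_forall_mem_le {k : ℕ} (ω : List (FormalComm k)) {f : ℝ → ℝ}
    {g : FormalComm k → ℝ → ℝ} (hg : ∀ x r, 1 ≤ r → 0 ≤ g x r)
    (h : ∀ x ∈ ω, ∃ C : ℝ, 1 ≤ C ∧ ∀ r, 1 ≤ r → f r ≤ C * g x r) :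
    ∃ C : ℝ, ∀ x ∈ ω, ∀ r, 1 ≤ r → f r ≤ C * g x r := by
  induction ω with
  | nil => exact ⟨0, by simp⟩
  | cons y t ih =>
    obtain ⟨C, hC⟩ := ih fun x hx => h x (List.mem_cons_of_mem _ hx)
    obtain ⟨C', -, hC'⟩ := h y List.mem_cons_self
    refine ⟨max C C', fun x hx r hr => ?_⟩
    rcases List.mem_cons.1 hx with rfl | hx
    · exact (hC' r hr).trans (mul_le_mul_of_nonneg_right (le_max_right _ _) (hg _ r hr))
    · exact (hC x hx r hr).trans (mul_le_mul_of_nonneg_right (le_max_left _ _) (hg _ r hr))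

end NilWalk

/-! ### Assembly of the comparison theorem -/

theorem mainTheorem12 {G : Type*} [Group G] [Group.IsNilpotent G] {k d : ℕ}
    (s : Fin k → G) (hs : Subgroup.closure (Set.range s) = ⊤)
    -- the weight system and the weight-function system
    (w : Fin k → Lex (Fin (d + 1) → ℝ)) (hw : ∀ i, 0 < ofLex (w i) 0)
    (F : Fin k → ℝ → ℝ) (hF : ∀ i, IsIncreasing (F i))
    (hF1 : IsDoublingSystem F) (hF2 : IsCompatible w F)
    -- the functions attached to the weight values
    (bF : ℕ → ℝ → ℝ) (hbF : ∀ j, 1 ≤ j → j ≤ jStar s w → IsIncreasing (bF j) ∧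
      ∀ c : FormalComm k, c.weightIndex w = j → Simeq (bF j) (c.weightFun F))
    -- formal commutators of minimal weight
    (c₀ c₁ : FormalComm k) (hc₀ : HasMinWeight w c₀) (hc₁ : HasMinWeight w c₁)
    (φ : ℝ → ℝ) (hφc : ContinuousOn φ (Set.Ici 0)) (hφpos : ∀ t, 0 ≤ t → 0 < φ t)
    (hφdoub : ∃ C : ℝ, ∀ l ∈ Set.Ioo (1 / 2 : ℝ) 2, ∀ t, 0 < t → φ t ≤ C * φ (l * t))
    (hφsum : Summable (radialWeight φ (comNorm s F c₀)))
    -- the one-dimensional laws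
    (p : Fin k → ℤ → ℝ)
    (hp_tor : ∀ i, IsOfFinOrder (s i) → IsSymmProb (p i))
    (hp : ∀ i, ¬ IsOfFinOrder (s i) → ∀ n,
      p i n = (∑' m, stepWeight φ (c₁.weightFun F) (bF (jIndex s w (s i))) m)⁻¹ *
        stepWeight φ (c₁.weightFun F) (bF (jIndex s w (s i))) n) :
    (∀ i, ¬ IsOfFinOrder (s i) →
      Summable (stepWeight φ (c₁.weightFun F) (bF (jIndex s w (s i))))) ∧
    (∃ C : ℝ, 0 < C ∧ ∀ f : G → ℝ,
      dirichlet (mixture s p) f ≤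
        ENNReal.ofReal C * dirichlet (radialMeasure φ (comNorm s F c₀)) f) ∧
    (∃ c : ℝ, 0 < c ∧ ∃ N : ℕ, 1 ≤ N ∧ ∀ n : ℕ,
      c * convPow (radialMeasure φ (comNorm s F c₀)) (2 * N * n) 1 ≤
        convPow (mixture s p) (2 * n) 1) := by
  have hk : 0 < k := by
    have pos (c : FormalComm k) : 0 < k := by
      induction c with
      | letter i b => exact i.pos
      | bracket _ _ h _ => exact h
    exact pos c₀
  have h01 := (hF2 c₀ c₁).1 (hc₀ c₁)
  have h10 := (hF2 c₁ c₀).1 (hc₁ c₀)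
  set r : G → ℝ := radialWeight φ (comNorm s F c₀) with hr
  have hrpos : ∀ x, 0 < r x := radialWeight_pos hs hF hF1 hφpos c₀
  have hinf : ∀ i, ¬ IsOfFinOrder (s i) →
      (∀ n, 0 < stepWeight φ (c₁.weightFun F) (bF (jIndex s w (s i))) n) ∧
      ∃ K : ℝ≥0∞, K ≠ ⊤ ∧ ∀ Δ : G → ℝ≥0∞, (∀ u y, Δ u ≤ 2 * (Δ y + Δ (u * y))) →
      ∑' n : ℤ, ENNReal.ofReal (stepWeight φ (c₁.weightFun F) (bF (jIndex s w (s i))) n) *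
        Δ (s i ^ n) ≤ K * ∑' y, ENNReal.ofReal (r y) * Δ y := by
    intro i hi
    obtain ⟨h1, h2, ⟨c, hc⟩, u, hu, hmem⟩ := jIndex_spec hw hi
    obtain ⟨hf, hfc⟩ := hbF _ h1 h2
    obtain ⟨ω, hω, he⟩ := exists_word_of_mem_filtration hmem
    obtain ⟨C, hC⟩ := exists_forall_mem_le (f := c.weightFun F)
      (g := fun x => x.weightFun F) ω
      (fun x _ hr => zero_le_one.trans (one_le_weightFun hF x hr))
      -- The letters of the word have index at least that of c, so compatibility makes each of their
      -- weight functions dominate F_c.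
      (fun x hx => (hF2 c x).1 ((FormalComm.weight_le_iff w hw c x).2 (hc ▸ hω x hx)))
    exact ⟨stepWeight_pos hF hφpos c₁ (exists_le_of_simeq hF hF1 (hfc c hc)),
      exists_tsum_stepWeight_le hs hF hF1 h01 h10 hφpos hφdoub hi hf (hfc c hc) hu he hC⟩
  have hsummable : ∀ i, ¬ IsOfFinOrder (s i) →
      Summable (stepWeight φ (c₁.weightFun F) (bF (jIndex s w (s i)))) := by
    intro i hi
    obtain ⟨hpos, K, hK, h⟩ := hinf i hi
    -- With Δ = 1 the comparison bounds the total step weight by the total radial weight, which is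
    -- finite.
    have h1 := h (fun _ => 1) (fun _ _ => by norm_num)
    simp only [mul_one] at h1
    have h2 := ENNReal.summable_toReal
      (h1.trans_lt (ENNReal.mul_lt_top hK.lt_top hφsum.tsum_ofReal_ne_top.lt_top)).ne
    exact h2.congr fun n => ENNReal.toReal_ofReal (hpos n).le
  have hprob : ∀ i, IsSymmProb (p i) := by
    intro i
    by_cases hi : IsOfFinOrder (s i)
    · exact hp_tor i hi
    · exact isSymmProb_stepWeight (hinf i hi).1 (hsummable i hi) (hp i hi)
  have hμ : IsSymmLaw (mixture s p) := isSymmLaw_mixture hk hprob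
  have hν : IsSymmLaw (radialMeasure φ (comNorm s F c₀)) :=
    isSymmLaw_radialMeasure (comNorm_inv c₀) hrpos hφsum
  have hstep : ∀ i, ∃ K : ℝ≥0∞, K ≠ ⊤ ∧ ∀ Δ : G → ℝ≥0∞,
      (∀ u y, Δ u ≤ 2 * (Δ y + Δ (u * y))) →
      ∑' n : ℤ, ENNReal.ofReal (p i n) * Δ (s i ^ n) ≤
        K * ∑' y, ENNReal.ofReal (r y) * Δ y := by
    intro i
    by_cases hi : IsOfFinOrder (s i)
    · obtain ⟨K, hK, h⟩ := exists_tsum_le_of_isOfFinOrder (hprob i) hi hrpos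
      exact ⟨K, hK, fun Δ _ => h Δ⟩
    · obtain ⟨hpos, K, hK, h⟩ := hinf i hi
      set S := ∑' m, stepWeight φ (c₁.weightFun F) (bF (jIndex s w (s i))) m
      have hS : 0 ≤ S⁻¹ := inv_nonneg.2 (tsum_nonneg fun n => (hpos n).le)
      refine ⟨ENNReal.ofReal S⁻¹ * K, ENNReal.mul_ne_top ENNReal.ofReal_ne_top hK,
        fun Δ hΔ => ?_⟩
      have hp' : ∀ n, p i n = S⁻¹ * stepWeight φ (c₁.weightFun F) (bF (jIndex s w (s i))) n :=
        hp i hi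
      simp only [hp', ENNReal.ofReal_mul hS, mul_assoc, ENNReal.tsum_mul_left]
      gcongr
      exact h Δ hΔ
  choose K hK hstep using hstep
  have hcomp : ∃ C : ℝ, 0 < C ∧ ∀ f : G → ℝ, dirichlet (mixture s p) f ≤
      ENNReal.ofReal C * dirichlet (radialMeasure φ (comNorm s F c₀)) f := by
    set S := ∑' x, r x with hS
    have hS0 : 0 < S := hφsum.tsum_pos (fun x => (hrpos x).le) 1 (hrpos 1)
    -- The factor S undoes the normalization of ν; the normalizations of the μ_i are already
    -- contained in the K i.
    set A : ℝ≥0∞ := ENNReal.ofReal (1 / k) * (∑ i, K i) * ENNReal.ofReal S with hA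
    have hAtop : A ≠ ⊤ := ENNReal.mul_ne_top (ENNReal.mul_ne_top ENNReal.ofReal_ne_top
      (ENNReal.sum_lt_top.2 fun i _ => (hK i).lt_top).ne) ENNReal.ofReal_ne_top
    refine ⟨A.toReal + 1, by positivity, fun f => ?_⟩
    have hAle : A ≤ ENNReal.ofReal (A.toReal + 1) := by
      conv_lhs => rw [← ENNReal.ofReal_toReal hAtop]
      exact ENNReal.ofReal_le_ofReal (by linarith)
    have hrν : ∀ y, ENNReal.ofReal (r y) = ENNReal.ofReal S *
        ENNReal.ofReal (radialMeasure φ (comNorm s F c₀) y) := by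
      intro y
      rw [← ENNReal.ofReal_mul hS0.le]
      congr 1
      change r y = S * (S⁻¹ * r y)
      rw [mul_inv_cancel_left₀ hS0.ne']
    refine le_trans ?_ (mul_le_mul_left hAle _)
    rw [dirichlet_eq_tsum_increment, dirichlet_eq_tsum_increment, tsum_mixture_mul hprob]
    set B := ∑' y, ENNReal.ofReal (radialMeasure φ (comNorm s F c₀) y) * increment f y
    have hB : ∑' y, ENNReal.ofReal (r y) * increment f y = ENNReal.ofReal S * B := by
      simp only [hrν, mul_assoc, ENNReal.tsum_mul_left, B]
    calc 1 / 2 * (ENNReal.ofReal (1 / k) *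
          ∑ i, ∑' n : ℤ, ENNReal.ofReal (p i n) * increment f (s i ^ n))
        ≤ 1 / 2 * (ENNReal.ofReal (1 / k) * ∑ i, K i * (ENNReal.ofReal S * B)) := by
          gcongr with i
          rw [← hB]
          exact hstep i _ (increment_le f)
      _ = A * (1 / 2 * B) := by rw [← Finset.sum_mul, hA]; ring
  refine ⟨hsummable, hcomp, ?_⟩
  obtain ⟨C, -, hC⟩ := hcomp
  exact hμ.exists_convPow_le hν hC
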